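/- Let $n\ge 1$ be an integer, $\alpha>0$ and $1<q\le 1+\frac{\alpha}{n}$. Let $$\mathcal L=\sum_{i,j=1}^n\frac{\partial}{\partial x_i}\Big[a_{ij}(t,x)\frac{\partial}{\partial x_j}\Big],$$ where the $a_{ij}$ are measurable, locally bounded real functions on $\mathbb E=\mathbb R\times\mathbb R^n$ with $a_{ij}=a_{ji}$ almost everywhere, and suppose that $$0\le\sum_{i,j=1}^n a_{ij}(t,x)\xi_i\xi_j\le A(t,x)|\xi|^2\qquad\text{for all }\xi\in\mathbb R^n\text{ and almost all }(t,x)\in\mathbb E,$$ where $A\ge 0$ is a measurable, locally bounded function on $\mathbb E$ such that, for some constant $c>0$, $$\operatorname*{ess\,sup}_{(t,x)\in\mathbb R\times\{R/2<|x|<R\}}A(t,x)\le c\,R^{2-\alpha}\qquad\text{for all }R>1 .$$ For a bounded domain $\Omega\subset\mathbb E$ let $W^{\mathcal L,q}(\Omega)$ be the completion of the space of the functions in $C^\infty(\Omega)$ of finite norm with respect to $$\|w\|=\int_\Omega|w_t|\,dt\,dx+\Big[\int_\Omega\sum_{i,j=1}^n a_{ij}\frac{\partial w}{\partial x_i}\frac{\partial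 w}{\partial x_j}\,dt\,dx\Big]^{1/2}+\Big[\int_\Omega|w|^{q}\,dt\,dx\Big]^{1/q}.$$ An element of this completion is a function $w$ together with generalized derivatives $w_t$ and $\nabla w=(\partial w/\partial x_1,\dots,\partial w/\partial x_n)$, the limits of the classical derivatives of an approximating sequence in the corresponding terms of the norm ($\nabla w$ is taken modulo the kernel of the matrix $(a_{ij})$). A measurable function $u$ on $\mathbb E$ is a weak solution of $u_t\ge\mathcal Lu+|u|^{q-1}u$ in $\mathbb E$ if there are $u_t$ and $\nabla u$ on $\mathbb E$ with which $u$ belongs to $W^{\mathcal L,q}(\Omega)$ for every bounded domain $\Omega\subset\mathbb E$, and such that $$\int_{\mathbb E}\Big[u_t\varphi+\sum_{i,j=1}^n a_{ij}\frac{\partial\varphi}{\partial x_i}\frac{\partial u}{\partial x_j}-|u|^{q-1}u\,\varphi\Big]dt\,dx\ge 0$$ for every non-negative $\varphi\in C^\infty(\mathbb E)$ with compact support. If $u$ is a weak solution of $u_t\ge\mathcal Lu+|u|^{q-1}u$ in $\mathbb E$ with $u\ge 0$ almost everywhere, then $u=0$ almost everywhere in $\mathbb E$. -/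

import Mathlib

open MeasureTheory Filter Topology
open scoped ENNReal ContDiff

noncomputable section

namespace ParabolicLiouville

/-- Points `(t, x)` of the whole space `ℝ × ℝⁿ`; the measure used is `dt dx = volume`. -/
abbrev SpaceTime (n : ℕ) : Type := ℝ × EuclideanSpace ℝ (Fin n)

/-- The classical time derivative `∂w/∂t`. -/
def timeDeriv {n : ℕ} (w : SpaceTime n → ℝ) (z : SpaceTime n) : ℝ :=
  fderiv ℝ w z (1, 0)

/-- The classical spatial gradient `(∂w/∂x₁, …, ∂w/∂xₙ)`. -/
def spaceGrad {n : ℕ} (w : SpaceTime n → ℝ) (z : SpaceTime n) : Fin n → ℝ :=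
  fun j => fderiv ℝ w z (0, EuclideanSpace.single j 1)

/-- The bilinear form `∑ aᵢⱼ(z) ξᵢ ηⱼ`. -/
def form {n : ℕ} (a : SpaceTime n → Matrix (Fin n) (Fin n) ℝ) (z : SpaceTime n)
    (ξ η : Fin n → ℝ) : ℝ :=
  ∑ i, ∑ j, a z i j * ξ i * η j

/-- A real function that is bounded on every compact set. -/
def LocallyBdd {n : ℕ} (f : SpaceTime n → ℝ) : Prop :=
  ∀ K : Set (SpaceTime n), IsCompact K → ∃ M : ℝ, ∀ z ∈ K, |f z| ≤ M

/-- Standing assumptions on the coefficients `aᵢⱼ` of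
`𝓛 = ∑ ∂/∂xᵢ (aᵢⱼ(t, x) ∂/∂xⱼ)` and on the function `A` that bounds the quadratic form.
(`AEMeasurable` with respect to `volume` is Lebesgue measurability.) -/
structure IsAdmissible {n : ℕ} (a : SpaceTime n → Matrix (Fin n) (Fin n) ℝ)
    (A : SpaceTime n → ℝ) : Prop where
  coeff_meas : ∀ i j, AEMeasurable (fun z => a z i j) volume
  coeff_bdd : ∀ i j, LocallyBdd (fun z => a z i j)
  symm : ∀ᵐ z, ∀ i j, a z i j = a z j i
  bound_meas : AEMeasurable A volume
  bound_nonneg : ∀ z, 0 ≤ A z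
  bound_bdd : LocallyBdd A
  form_nonneg : ∀ᵐ z, ∀ ξ : Fin n → ℝ, 0 ≤ form a z ξ ξ
  form_le : ∀ᵐ z, ∀ ξ : Fin n → ℝ, form a z ξ ξ ≤ A z * ∑ i, ξ i ^ 2

/-- `𝓐(R) = ess sup A` over `(-∞, ∞) × {R/2 < |x| < R}`, a value in `[0, ∞]`. -/
def annulusSup {n : ℕ} (A : SpaceTime n → ℝ) (R : ℝ) : ℝ≥0∞ :=
  essSup (fun z => ENNReal.ofReal (A z))
    (volume.restrict {z : SpaceTime n | R / 2 < ‖z.2‖ ∧ ‖z.2‖ < R})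

/-- The norm `∫_Ω |g| + (∫_Ω ∑ aᵢⱼ Vᵢ Vⱼ)^(1/2) + (∫_Ω |w|^q̂)^(1/q̂)`, `q̂ = max {1, q}`,
of a triple consisting of a function `w`, a time derivative `g` and a spatial gradient `V`. -/
def tripleNorm {n : ℕ} (a : SpaceTime n → Matrix (Fin n) (Fin n) ℝ) (q : ℝ)
    (Ω : Set (SpaceTime n)) (w g : SpaceTime n → ℝ) (V : SpaceTime n → Fin n → ℝ) : ℝ≥0∞ :=
  (∫⁻ z in Ω, ENNReal.ofReal |g z|)
    + (∫⁻ z in Ω, ENNReal.ofReal (form a z (V z) (V z))) ^ (1 / 2 : ℝ)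
    + (∫⁻ z in Ω, ENNReal.ofReal (|w z| ^ max 1 q)) ^ (1 / max 1 q)

/-- The function `w`, with generalized time derivative `g` and generalized spatial gradient `V`,
is an element of the completion `W^{𝓛,q}(Ω)` of (the functions of finite norm in) `C^∞(Ω)` with
respect to `‖w‖ = tripleNorm a q Ω w w_t ∇w`.

The spaces `L¹(Ω)`, `L^q̂(Ω)` and the space of measurable vector fields with the seminorm
`(∫_Ω ∑ aᵢⱼ Vᵢ Vⱼ)^(1/2)` being complete, the elements of the completion are exactly the limits
`(w, g, V)` of the triples `(φₖ, ∂ₜφₖ, ∇φₖ)`, `φₖ ∈ C^∞(Ω)`; `V` matters only modulo the kernel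
of the (possibly degenerate) matrix `a`. -/
def MemW {n : ℕ} (a : SpaceTime n → Matrix (Fin n) (Fin n) ℝ) (q : ℝ)
    (Ω : Set (SpaceTime n)) (w g : SpaceTime n → ℝ) (V : SpaceTime n → Fin n → ℝ) : Prop :=
  AEMeasurable w (volume.restrict Ω) ∧ AEMeasurable g (volume.restrict Ω) ∧
  AEMeasurable V (volume.restrict Ω) ∧
  ∃ φ : ℕ → SpaceTime n → ℝ,
    (∀ k, ContDiffOn ℝ ∞ (φ k) Ω) ∧
    (∀ k, tripleNorm a q Ω (φ k) (timeDeriv (φ k)) (spaceGrad (φ k)) < ⊤) ∧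
    Tendsto (fun k => tripleNorm a q Ω (fun z => φ k z - w z)
      (fun z => timeDeriv (φ k) z - g z) (fun z => spaceGrad (φ k) z - V z)) atTop (𝓝 0)

/-- The function `w`, with generalized derivatives `g = w_t` and `V = ∇w`, belongs to
`W^{𝓛,q}_loc(ℝ × ℝⁿ)`, i.e. to `W^{𝓛,q}(Ω)` for every bounded domain `Ω`. -/
def MemWLoc {n : ℕ} (a : SpaceTime n → Matrix (Fin n) (Fin n) ℝ) (q : ℝ)
    (w g : SpaceTime n → ℝ) (V : SpaceTime n → Fin n → ℝ) : Prop :=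
  ∀ Ω : Set (SpaceTime n), IsOpen Ω → IsConnected Ω → Bornology.IsBounded Ω →
    MemW a q Ω w g V

/-- `u` is a weak solution of `u_t ≥ 𝓛u + |u|^{q-1}u` in `ℝ × ℝⁿ`: a measurable function in
`W^{𝓛,q}_loc` (with derivatives `g = u_t`, `V = ∇u`) such that
`∫ (u_t φ + ∑ aᵢⱼ ∂ᵢφ ∂ⱼu - |u|^{q-1}u φ) ≥ 0` for all non-negative test functions `φ`. -/
def IsWeakSolution {n : ℕ} (a : SpaceTime n → Matrix (Fin n) (Fin n) ℝ) (q : ℝ)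
    (u : SpaceTime n → ℝ) : Prop :=
  AEMeasurable u volume ∧
  ∃ (g : SpaceTime n → ℝ) (V : SpaceTime n → Fin n → ℝ), MemWLoc a q u g V ∧
    ∀ φ : SpaceTime n → ℝ, ContDiff ℝ ∞ φ → HasCompactSupport φ → (∀ z, 0 ≤ φ z) →
      0 ≤ ∫ z, (g z * φ z + form a z (spaceGrad φ z) (V z) - |u z| ^ (q - 1) * u z * φ z)

end ParabolicLiouville

end

noncomputable section

namespace ParabolicLiouville

/-! ### The possibly degenerate quadratic form: Cauchy–Schwarz and absorption. -/

section Form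

variable {n : ℕ} {a : SpaceTime n → Matrix (Fin n) (Fin n) ℝ} {z : SpaceTime n}

/-! The inequality is tested with `F(u) ψ`, where `F` is a smooth decreasing function with `1 ≤ F ≤
M` and `ψ` is a power of a cutoff equal to `1` on the cylinder `|t| ≤ R^α`, `|x| ≤ R`. Since `F ≥
1`, the left side controls `∫ u^q ψ`. Since `F' < 0`, the term `F'(u) ψ |∇u|²` (in the form `a`) has
a good sign and absorbs the cross term, at the cost of `F² |∇ψ|² / (4 |F'(u)| ψ)`. The time term is
integrated by parts through a primitive of `F`, which grows at most linearly.

The profile has a scale `τ`, with bounds `1 ≤ F ≤ M` independent of `τ` and `1/|F'(u)| ≤ C (τ +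
τ^(-β) u^(1+β))`, where `0 < β < q - 1`. The growth condition on `A` makes the time and gradient
errors both of size `R^(-α)`. Hölder's inequality on a set of volume at most a multiple of
`R^(n+α)`, with `τ = δ R^(-n)`, then gives for `w = u^q ψ` and `Y` its integral outside the inner
cylinder `∫ w ≤ C (Y^(1/q) + δ + δ^(-β) Y^((1+β)/q))`, with `C` independent of `R` and `δ`. The
remaining powers of `R` are nonpositive exactly because `n (q - 1) ≤ α`. This is
`exists_weighted_estimate`; it rests on `weak_inequality_comp`, which justifies the test function by
smooth approximation, and on `exists_scaled_profile`.

Both powers of `Y` are below `1`. Taking `δ = 1` and `Y ≤ ∫ w` bounds `∫ w` uniformly in `R`, so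
`u^q` is integrable. Hence `Y → 0` as `R → ∞`, leaving `∫ u^q ≤ C δ` for every `δ > 0`. The free
parameter `δ` is what settles the critical case `q = 1 + α/n`. -/

lemma form_linear_left (c d : ℝ) (ξ η ζ : Fin n → ℝ) :
    form a z (c • ξ + d • η) ζ = c * form a z ξ ζ + d * form a z η ζ := by
  simp only [form, Finset.mul_sum, ← Finset.sum_add_distrib, Pi.add_apply, Pi.smul_apply,
    smul_eq_mul]
  refine Finset.sum_congr rfl fun i _ => Finset.sum_congr rfl fun j _ => by ring

lemma form_linear_right (c d : ℝ) (ξ η ζ : Fin n → ℝ) :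
    form a z ζ (c • ξ + d • η) = c * form a z ζ ξ + d * form a z ζ η := by
  simp only [form, Finset.mul_sum, ← Finset.sum_add_distrib, Pi.add_apply, Pi.smul_apply,
    smul_eq_mul]
  refine Finset.sum_congr rfl fun i _ => Finset.sum_congr rfl fun j _ => by ring

lemma form_comm (hs : ∀ i j, a z i j = a z j i) (ξ η : Fin n → ℝ) :
    form a z ξ η = form a z η ξ := by
  unfold form
  rw [Finset.sum_comm]
  refine Finset.sum_congr rfl fun i _ => Finset.sum_congr rfl fun j _ => ?_
  rw [hs j i]; ring

lemma form_quadratic (hs : ∀ i j, a z i j = a z j i) (c d : ℝ) (ξ η : Fin n → ℝ) :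
    form a z (c • ξ + d • η) (c • ξ + d • η)
      = c ^ 2 * form a z ξ ξ + 2 * c * d * form a z ξ η + d ^ 2 * form a z η η := by
  rw [form_linear_left, form_linear_right, form_linear_right, form_comm hs η ξ]
  ring

lemma form_cauchy_schwarz (hs : ∀ i j, a z i j = a z j i) (hp : ∀ ξ, 0 ≤ form a z ξ ξ)
    (ξ η : Fin n → ℝ) : form a z ξ η ^ 2 ≤ form a z ξ ξ * form a z η η := by
  have h := discrim_le_zero (a := form a z ξ ξ) (b := 2 * form a z ξ η) (c := form a z η η)
    (fun x => by
      have := hp (x • ξ + (1 : ℝ) • η)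
      rw [form_quadratic hs] at this
      nlinarith)
  unfold discrim at h
  nlinarith

lemma abs_form_le_half (hs : ∀ i j, a z i j = a z j i) (hp : ∀ ξ, 0 ≤ form a z ξ ξ)
    (ξ η : Fin n → ℝ) : |form a z ξ η| ≤ (form a z ξ ξ + form a z η η) / 2 := by
  have h1 := hp ((1 : ℝ) • ξ + (1 : ℝ) • η)
  have h2 := hp ((1 : ℝ) • ξ + (-1 : ℝ) • η)
  rw [form_quadratic hs] at h1 h2
  rw [abs_le]
  constructor <;> linarith

lemma enorm_form_le (hs : ∀ i j, a z i j = a z j i) (hp : ∀ ξ, 0 ≤ form a z ξ ξ)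
    (ξ η : Fin n → ℝ) :
    ‖form a z ξ η‖ₑ ≤ ENNReal.ofReal (form a z ξ ξ) ^ (1 / 2 : ℝ)
      * ENNReal.ofReal (form a z η η) ^ (1 / 2 : ℝ) := by
  rw [Real.enorm_eq_ofReal_abs, ENNReal.ofReal_rpow_of_nonneg (hp ξ) (by norm_num),
    ENNReal.ofReal_rpow_of_nonneg (hp η) (by norm_num),
    ← ENNReal.ofReal_mul (Real.rpow_nonneg (hp ξ) _)]
  apply ENNReal.ofReal_le_ofReal
  rw [← Real.mul_rpow (hp ξ) (hp η), ← Real.sqrt_eq_rpow]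
  exact Real.abs_le_sqrt (form_cauchy_schwarz hs hp ξ η)

/-- The difference of the two sides is the form at `2ξ - η`. It transfers finite energy from one
approximant to the limit gradient. -/
lemma form_le_two_mul (hs : ∀ i j, a z i j = a z j i) (hp : ∀ ξ, 0 ≤ form a z ξ ξ)
    (ξ η : Fin n → ℝ) :
    form a z η η ≤ 2 * form a z ξ ξ + 2 * form a z (ξ - η) (ξ - η) := by
  have h1 := hp ((2 : ℝ) • ξ + (-1 : ℝ) • η)
  have h2 := form_quadratic hs 1 (-1) ξ η
  have e : (1 : ℝ) • ξ + (-1 : ℝ) • η = ξ - η := by simp [sub_eq_add_neg]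
  rw [form_quadratic hs] at h1
  rw [e] at h2
  rw [h2]
  nlinarith

/-- Completing the square: the absorption of the gradient term. -/
lemma absorb_gradient (hs : ∀ i j, a z i j = a z j i) (hp : ∀ ξ, 0 ≤ form a z ξ ξ)
    {p f x : ℝ} (hpos : 0 < p) (hx : 0 ≤ x) (s m : ℕ) (ξ η : Fin n → ℝ) :
    -p * x ^ (m + 2) * form a z η η + f * (s * x ^ (m + 1) * form a z ξ η)
      ≤ f ^ 2 * s ^ 2 / 4 * (1 / p) * x ^ m * form a z ξ ξ := by
  -- This square, multiplied by `x ^ m / p`, is exactly the difference of the two sides; the weight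
  -- avoids dividing by `x`, which may vanish.
  have h1 := hp ((p * x) • η + (-(f * s / 2)) • ξ)
  rw [form_quadratic hs, form_comm hs η ξ] at h1
  have h2 : 0 ≤ x ^ m / p * ((p * x) ^ 2 * form a z η η
      + 2 * (p * x) * -(f * s / 2) * form a z ξ η + (-(f * s / 2)) ^ 2 * form a z ξ ξ) :=
    mul_nonneg (by positivity) h1
  have h3 : x ^ m / p * ((p * x) ^ 2 * form a z η η
      + 2 * (p * x) * -(f * s / 2) * form a z ξ η + (-(f * s / 2)) ^ 2 * form a z ξ ξ)
      = f ^ 2 * s ^ 2 / 4 * (1 / p) * x ^ m * form a z ξ ξ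
        - (-p * x ^ (m + 2) * form a z η η + f * (s * x ^ (m + 1) * form a z ξ η)) := by
    field_simp
    ring
  linarith

lemma aemeasurable_form {μ : Measure (SpaceTime n)} {ξ η : SpaceTime n → Fin n → ℝ}
    (ha : ∀ i j, AEMeasurable (fun z => a z i j) μ) (hξ : AEMeasurable ξ μ)
    (hη : AEMeasurable η μ) : AEMeasurable (fun z => form a z (ξ z) (η z)) μ := by
  unfold form
  have h1 := aemeasurable_pi_iff.1 hξ
  have h2 := aemeasurable_pi_iff.1 hη
  refine Finset.aemeasurable_fun_sum _ fun i _ => Finset.aemeasurable_fun_sum _ fun j _ => ?_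
  exact ((ha i j).mul (h1 i)).mul (h2 j)

end Form

/-! ### The decreasing profile and its primitive. -/

section Profile

/-- The prescribed derivative is integrable on the line because `β > 0`, so its primitive is
bounded; adding `1` plus the total mass keeps it above `1`. -/
lemma exists_profile {β : ℝ} (hβ : 0 < β) :
    ∃ (F : ℝ → ℝ) (M : ℝ), ContDiff ℝ ∞ F ∧ (∀ r, 1 ≤ F r ∧ F r ≤ M) ∧
      ∀ r, HasDerivAt F (-(1 + r ^ 2) ^ (-(1 + β) / 2)) r := by
  set k : ℝ → ℝ := fun r => (1 + r ^ 2) ^ (-(1 + β) / 2) with hk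
  have hk0 : ∀ r, 0 ≤ k r := fun r => by simp only [hk]; positivity
  have hks : ContDiff ℝ ∞ k := by
    refine ContDiff.rpow_const_of_ne (by fun_prop) fun x => ?_
    positivity
  have hki : Integrable k := by
    have := integrable_rpow_neg_one_add_norm_sq (E := ℝ) (r := 1 + β) (μ := volume)
      (by simp; exact hβ)
    refine this.congr (ae_of_all _ fun x => ?_)
    simp [hk]
  have hI : ∀ r, |∫ s in (0 : ℝ)..r, k s| ≤ ∫ s, k s := fun r => by
    rw [← Real.norm_eq_abs]
    refine (intervalIntegral.norm_integral_le_integral_norm_uIoc).trans ?_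
    have : ∀ s, ‖k s‖ = k s := fun s => Real.norm_of_nonneg (hk0 s)
    simp only [this]
    exact setIntegral_le_integral hki (ae_of_all _ hk0)
  have hd : ∀ r, HasDerivAt (fun r => (1 + ∫ s, k s) - ∫ s in (0 : ℝ)..r, k s) (-k r) r :=
    fun r => by
      have := (hks.continuous.integral_hasStrictDerivAt 0 r).hasDerivAt
      exact this.const_sub _
  refine ⟨fun r => (1 + ∫ s, k s) - ∫ s in (0 : ℝ)..r, k s, 1 + 2 * ∫ s, k s, ?_, ?_, hd⟩
  · rw [contDiff_infty_iff_deriv]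
    refine ⟨fun r => (hd r).differentiableAt, ?_⟩
    rw [show deriv _ = _ from funext fun r => (hd r).deriv]
    exact hks.neg
  · intro r
    have := abs_le.1 (hI r)
    constructor <;> linarith

/-- Dilating the argument by `τ` leaves the range of the profile unchanged and divides its slope by
`τ`. The bounds `M` and `C` are thus uniform in `τ`, which may later depend on `R`. -/
lemma exists_scaled_profile {β : ℝ} (hβ : 0 < β) :
    ∃ (M C : ℝ), 0 < M ∧ 0 < C ∧ ∀ τ : ℝ, 0 < τ → ∃ (F F' : ℝ → ℝ), ContDiff ℝ ∞ F ∧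
      Continuous F' ∧ (∀ r, HasDerivAt F (F' r) r) ∧ (∀ r, 1 ≤ F r ∧ F r ≤ M) ∧
      (∀ r, F' r < 0) ∧ (∀ r, |F' r| ≤ τ⁻¹) ∧
      ∀ r, 0 ≤ r → 1 / (-F' r) ≤ C * (τ + τ ^ (-β) * r ^ (1 + β)) := by
  obtain ⟨F, M, hF, hM, hd⟩ := exists_profile hβ
  refine ⟨M, 2 ^ ((1 + β) / 2), ?_, by positivity, ?_⟩
  · have := hM 0; linarith
  intro τ hτ
  refine ⟨fun r => F (r / τ), fun r => -(1 + (r / τ) ^ 2) ^ (-(1 + β) / 2) / τ, ?_, ?_, ?_,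
    fun r => hM _, ?_, ?_, ?_⟩
  · exact hF.comp (by fun_prop)
  · refine Continuous.div_const (Continuous.neg (Continuous.rpow_const (by fun_prop) ?_)) _
    intro x; left; positivity
  · intro r
    have := (hd (r / τ)).comp r ((hasDerivAt_id r).div_const τ)
    refine this.congr_deriv ?_
    ring
  · intro r
    apply div_neg_of_neg_of_pos _ hτ
    rw [neg_lt_zero]
    positivity
  · intro r
    rw [abs_div, abs_neg, abs_of_pos hτ, abs_of_nonneg (by positivity), div_eq_mul_inv]
    apply mul_le_of_le_one_left (by positivity)
    apply Real.rpow_le_one_of_one_le_of_nonpos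
    · nlinarith [sq_nonneg (r / τ)]
    · linarith
  · intro r hr
    set x := r / τ with hx
    have hx0 : 0 ≤ x := by positivity
    have e1 : 1 / -(-(1 + x ^ 2) ^ (-(1 + β) / 2) / τ) = τ * (1 + x ^ 2) ^ ((1 + β) / 2) := by
      rw [show -(1 + β) / 2 = -((1 + β) / 2) by ring, Real.rpow_neg (by positivity)]
      have : (0 : ℝ) < (1 + x ^ 2) ^ ((1 + β) / 2) := by positivity
      field_simp
    have e2 : τ * x ^ (1 + β) = τ ^ (-β) * r ^ (1 + β) := by
      rw [hx, Real.div_rpow hr hτ.le, Real.rpow_neg hτ.le, Real.rpow_add hτ, Real.rpow_one]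
      have : (0 : ℝ) < τ ^ β := by positivity
      field_simp
    have e3 : (1 + x ^ 2) ^ ((1 + β) / 2) ≤ 2 ^ ((1 + β) / 2) * (1 + x ^ (1 + β)) := by
      have hm : 1 + x ^ 2 ≤ 2 * (max 1 x) ^ 2 := by
        have h1 : (1 : ℝ) ≤ max 1 x := le_max_left _ _
        have h2 : x ≤ max 1 x := le_max_right _ _
        nlinarith
      have hm0 : (0 : ℝ) ≤ max 1 x := zero_le_one.trans (le_max_left _ _)
      calc (1 + x ^ 2) ^ ((1 + β) / 2) ≤ (2 * (max 1 x) ^ 2) ^ ((1 + β) / 2) :=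
            Real.rpow_le_rpow (by positivity) hm (by positivity)
        _ = 2 ^ ((1 + β) / 2) * (max 1 x) ^ (1 + β) := by
            rw [Real.mul_rpow (by norm_num) (by positivity), ← Real.rpow_natCast (max 1 x) 2,
              ← Real.rpow_mul hm0]
            congr 2; push_cast; ring
        _ ≤ _ := by
            gcongr
            rcases le_total 1 x with h | h
            · rw [max_eq_right h]; linarith
            · rw [max_eq_left h, Real.one_rpow]
              have : 0 ≤ x ^ (1 + β) := by positivity
              linarith
    change 1 / -(-(1 + x ^ 2) ^ (-(1 + β) / 2) / τ) ≤ _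
    rw [e1, ← e2]
    calc _ ≤ τ * (2 ^ ((1 + β) / 2) * (1 + x ^ (1 + β))) := by gcongr
      _ = _ := by ring

/-- The primitive of a bounded smooth function that vanishes at the origin. -/
lemma exists_primitive {F : ℝ → ℝ} {M : ℝ} (hF : ContDiff ℝ ∞ F) (hM : ∀ r, |F r| ≤ M) :
    ∃ G : ℝ → ℝ, ContDiff ℝ ∞ G ∧ (∀ r, HasDerivAt G (F r) r) ∧
      (∀ r s, |G r - G s| ≤ M * |r - s|) ∧ ∀ r, |G r| ≤ M * |r| := by
  have hd : ∀ r, HasDerivAt (fun r => ∫ s in (0 : ℝ)..r, F s) (F r) r := fun r =>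
    (hF.continuous.integral_hasStrictDerivAt 0 r).hasDerivAt
  have hl : ∀ r s, |(∫ x in (0 : ℝ)..r, F x) - ∫ x in (0 : ℝ)..s, F x| ≤ M * |r - s| := by
    intro r s
    rw [intervalIntegral.integral_interval_sub_left
      (hF.continuous.intervalIntegrable _ _) (hF.continuous.intervalIntegrable _ _)]
    have := intervalIntegral.norm_integral_le_of_norm_le_const (f := F) (a := s) (b := r) (C := M)
      fun x _ => by simpa using hM x
    simpa using this
  refine ⟨_, ?_, hd, hl, fun r => ?_⟩
  · rw [contDiff_infty_iff_deriv]
    refine ⟨fun r => (hd r).differentiableAt, ?_⟩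
    rw [show deriv _ = _ from funext fun r => (hd r).deriv]
    exact hF
  · simpa using hl r 0

end Profile

/-! ### Parabolic cylinders and cutoff functions. -/

section Cutoff

variable {n : ℕ}

/-- The parabolic cylinder `{|t| ≤ R^α, |x| ≤ R}`, dilated by `m`. -/
def cylinder (n : ℕ) (α R m : ℝ) : Set (SpaceTime n) :=
  {z | |z.1| ≤ m * R ^ α ∧ ‖z.2‖ ≤ m * R}

lemma cylinder_eq (α R m : ℝ) : cylinder n α R m
    = Metric.closedBall (0 : ℝ) (m * R ^ α) ×ˢ
      Metric.closedBall (0 : EuclideanSpace ℝ (Fin n)) (m * R) := by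
  ext z; simp [cylinder]

lemma isCompact_cylinder (α R m : ℝ) : IsCompact (cylinder n α R m) := by
  rw [cylinder_eq]
  exact (isCompact_closedBall _ _).prod (isCompact_closedBall _ _)

lemma exists_volume_cylinder_le (n : ℕ) (α : ℝ) : ∃ C : ℝ, 0 < C ∧ ∀ R : ℝ, 0 < R →
    volume.real (cylinder n α R 2) ≤ C * R ^ (n + α) := by
  set v := volume.real (Metric.ball (0 : EuclideanSpace ℝ (Fin n)) 1)
  have hv : 0 ≤ v := measureReal_nonneg
  refine ⟨4 * 2 ^ n * v + 1, by positivity, fun R hR => ?_⟩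
  rw [cylinder_eq, Measure.volume_eq_prod, measureReal_prod_prod]
  have h1 : volume.real (Metric.closedBall (0 : ℝ) (2 * R ^ α)) = 4 * R ^ α := by
    rw [measureReal_def, Real.volume_closedBall, ENNReal.toReal_ofReal (by positivity)]
    ring
  have h2 : volume.real (Metric.closedBall (0 : EuclideanSpace ℝ (Fin n)) (2 * R))
      = (2 * R) ^ n * v := by
    rw [measureReal_def, Measure.addHaar_closedBall _ _ (by positivity), ENNReal.toReal_mul,
      ENNReal.toReal_ofReal (by positivity)]
    simp [v, measureReal_def]
  rw [h1, h2, Real.rpow_add hR, Real.rpow_natCast]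
  have : 0 ≤ R ^ n * R ^ α := by positivity
  calc _ = (4 * 2 ^ n * v) * (R ^ n * R ^ α) := by rw [mul_pow]; ring
    _ ≤ _ := by gcongr; linarith

/-- The bump attains its global maximum or minimum at such points, so the bounding spheres are
included as well. -/
lemma ContDiffBump.fderiv_eq_zero {E : Type*} [NormedAddCommGroup E] [InnerProductSpace ℝ E]
    [FiniteDimensional ℝ E] (f : ContDiffBump (0 : E)) {x : E}
    (h : ‖x‖ ≤ f.rIn ∨ f.rOut ≤ ‖x‖) : fderiv ℝ f x = 0 := by
  rcases h with h | h
  · have h1 : f x = 1 := f.one_of_mem_closedBall (by simpa using h)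
    exact IsLocalMax.fderiv_eq_zero (Filter.Eventually.of_forall fun y => by
      rw [h1]; exact f.le_one)
  · have h1 : f x = 0 := f.zero_of_le_dist (by simpa using h)
    exact IsLocalMin.fderiv_eq_zero (Filter.Eventually.of_forall fun y => by
      rw [h1]; exact f.nonneg)

/-- A product of fixed bumps in `t / R^α` and `x / R`. The spatial gradient lives in `R < |x| < 2R`,
at all times: this is the only region where the size of `A` has to be known. -/
lemma exists_cutoff (n : ℕ) (α : ℝ) : ∃ C : ℝ, 0 < C ∧ ∀ R : ℝ, 0 < R →
    ∃ χ : SpaceTime n → ℝ, ContDiff ℝ ∞ χ ∧ (∀ z, 0 ≤ χ z ∧ χ z ≤ 1) ∧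
      (∀ z ∈ cylinder n α R 1, χ z = 1) ∧ (∀ z ∉ cylinder n α R 2, χ z = 0) ∧
      (∀ z, |timeDeriv χ z| ≤ C * R ^ (-α)) ∧
      (∀ z, ∑ i, spaceGrad χ z i ^ 2 ≤ C * R ^ (-2 : ℝ)) ∧
      (∀ z, z ∈ cylinder n α R 1 ∨ z ∉ cylinder n α R 2 → fderiv ℝ χ z = 0) ∧
      ∀ z : SpaceTime n, ¬ (R < ‖z.2‖ ∧ ‖z.2‖ < 2 * R) → spaceGrad χ z = 0 := by
  let η : ContDiffBump (0 : ℝ) := ⟨1, 2, by norm_num, by norm_num⟩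
  let ζ : ContDiffBump (0 : EuclideanSpace ℝ (Fin n)) := ⟨1, 2, by norm_num, by norm_num⟩
  have hηs : ContDiff ℝ ∞ η := η.contDiff
  have hζs : ContDiff ℝ ∞ ζ := ζ.contDiff
  obtain ⟨C₁, hC₁⟩ := (hηs.continuous_fderiv (by simp)).bounded_above_of_compact_support
    (HasCompactSupport.fderiv (𝕜 := ℝ) η.hasCompactSupport)
  obtain ⟨C₂, hC₂⟩ := (hζs.continuous_fderiv (by simp)).bounded_above_of_compact_support
    (HasCompactSupport.fderiv (𝕜 := ℝ) ζ.hasCompactSupport)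
  refine ⟨1 + |C₁| + n * C₂ ^ 2, by positivity, fun R hR => ?_⟩
  have hRα : 0 < R ^ α := by positivity
  have hd : ∀ z : SpaceTime n, HasFDerivAt
      (fun z : SpaceTime n => η ((R ^ α)⁻¹ • z.1) * ζ (R⁻¹ • z.2))
      (η ((R ^ α)⁻¹ • z.1) • ((fderiv ℝ ζ (R⁻¹ • z.2)).comp
          (R⁻¹ • ContinuousLinearMap.snd ℝ ℝ (EuclideanSpace ℝ (Fin n))))
        + ζ (R⁻¹ • z.2) • ((fderiv ℝ η ((R ^ α)⁻¹ • z.1)).comp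
          ((R ^ α)⁻¹ • ContinuousLinearMap.fst ℝ ℝ (EuclideanSpace ℝ (Fin n))))) z := by
    intro z
    have h1 : HasFDerivAt (fun z : SpaceTime n => η ((R ^ α)⁻¹ • z.1))
        ((fderiv ℝ η ((R ^ α)⁻¹ • z.1)).comp
          ((R ^ α)⁻¹ • ContinuousLinearMap.fst ℝ ℝ (EuclideanSpace ℝ (Fin n)))) z :=
      ((hηs.differentiable (by simp)) _).hasFDerivAt.comp z
        (((R ^ α)⁻¹ • ContinuousLinearMap.fst ℝ ℝ (EuclideanSpace ℝ (Fin n))).hasFDerivAt)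
    have h2 : HasFDerivAt (fun z : SpaceTime n => ζ (R⁻¹ • z.2))
        ((fderiv ℝ ζ (R⁻¹ • z.2)).comp
          (R⁻¹ • ContinuousLinearMap.snd ℝ ℝ (EuclideanSpace ℝ (Fin n)))) z :=
      ((hζs.differentiable (by simp)) _).hasFDerivAt.comp z
        ((R⁻¹ • ContinuousLinearMap.snd ℝ ℝ (EuclideanSpace ℝ (Fin n))).hasFDerivAt)
    exact h1.mul h2
  have hgrad : ∀ z : SpaceTime n, spaceGrad
      (fun z : SpaceTime n => η ((R ^ α)⁻¹ • z.1) * ζ (R⁻¹ • z.2)) z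
      = fun j => η ((R ^ α)⁻¹ • z.1) *
        (R⁻¹ * fderiv ℝ ζ (R⁻¹ • z.2) (EuclideanSpace.single j 1)) := by
    intro z; ext j
    unfold spaceGrad
    rw [(hd z).fderiv]
    simp
  have hnn : ∀ z : SpaceTime n, 0 ≤ η ((R ^ α)⁻¹ • z.1) * ζ (R⁻¹ • z.2) := fun z =>
    mul_nonneg η.nonneg ζ.nonneg
  have hle : ∀ z : SpaceTime n, η ((R ^ α)⁻¹ • z.1) * ζ (R⁻¹ • z.2) ≤ 1 := fun z =>
    mul_le_one₀ η.le_one ζ.nonneg ζ.le_one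
  have hnorm1 : ∀ z : SpaceTime n, ‖(R ^ α)⁻¹ • z.1‖ = (R ^ α)⁻¹ * |z.1| := fun z => by
    rw [norm_smul, norm_inv, Real.norm_of_nonneg hRα.le, Real.norm_eq_abs]
  have hnorm2 : ∀ z : SpaceTime n, ‖R⁻¹ • z.2‖ = R⁻¹ * ‖z.2‖ := fun z => by
    rw [norm_smul, norm_inv, Real.norm_of_nonneg hR.le]
  have hone : ∀ z ∈ cylinder n α R 1, η ((R ^ α)⁻¹ • z.1) * ζ (R⁻¹ • z.2) = 1 := by
    rintro z ⟨h1, h2⟩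
    rw [one_mul] at h1 h2
    rw [η.one_of_mem_closedBall, ζ.one_of_mem_closedBall, one_mul]
    · rw [mem_closedBall_zero_iff, hnorm2, inv_mul_le_iff₀ hR]; simpa [ζ] using h2
    · rw [mem_closedBall_zero_iff, hnorm1, inv_mul_le_iff₀ hRα]; simpa [η] using h1
  have hzero : ∀ z ∉ cylinder n α R 2, η ((R ^ α)⁻¹ • z.1) * ζ (R⁻¹ • z.2) = 0 := by
    intro z hz
    by_cases h1 : |z.1| ≤ 2 * R ^ α
    · have h2 : 2 * R < ‖z.2‖ := by
        by_contra h; exact hz ⟨h1, not_lt.1 h⟩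
      rw [ζ.zero_of_le_dist, mul_zero]
      rw [dist_zero_right, hnorm2, le_inv_mul_iff₀ hR]; simp only [ζ]; linarith
    · rw [η.zero_of_le_dist, zero_mul]
      rw [dist_zero_right, hnorm1, le_inv_mul_iff₀ hRα]; simp only [η]; linarith
  refine ⟨fun z => η ((R ^ α)⁻¹ • z.1) * ζ (R⁻¹ • z.2), ?_, fun z => ⟨hnn z, hle z⟩, hone,
    hzero, ?_, ?_, ?_, ?_⟩
  · exact (hηs.comp (by fun_prop)).mul (hζs.comp (by fun_prop))
  · intro z
    unfold timeDeriv
    rw [(hd z).fderiv]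
    simp only [add_apply, smul_apply,
      ContinuousLinearMap.comp_apply, ContinuousLinearMap.coe_snd', ContinuousLinearMap.coe_fst',
      smul_zero, map_zero, smul_eq_mul, mul_zero, zero_add, mul_one]
    rw [abs_mul, abs_of_nonneg ζ.nonneg, Real.rpow_neg hR.le]
    have h1 : |fderiv ℝ η ((R ^ α)⁻¹ • z.1) (R ^ α)⁻¹| ≤ |C₁| * (R ^ α)⁻¹ := by
      have := (fderiv ℝ η ((R ^ α)⁻¹ • z.1)).le_opNorm (R ^ α)⁻¹
      rw [Real.norm_eq_abs, norm_inv, Real.norm_of_nonneg hRα.le] at this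
      refine this.trans ?_
      gcongr
      exact (hC₁ _).trans (le_abs_self _)
    refine (mul_le_of_le_one_left (abs_nonneg _) ζ.le_one).trans (h1.trans ?_)
    gcongr
    nlinarith [sq_nonneg C₂, (Nat.cast_nonneg n : (0 : ℝ) ≤ n)]
  · intro z
    rw [hgrad]
    have h1 : ∀ i : Fin n, (η ((R ^ α)⁻¹ • z.1) *
        (R⁻¹ * fderiv ℝ ζ (R⁻¹ • z.2) (EuclideanSpace.single i 1))) ^ 2
          ≤ C₂ ^ 2 * R ^ (-2 : ℝ) := by
      intro i
      have h2 := (fderiv ℝ ζ (R⁻¹ • z.2)).le_opNorm (EuclideanSpace.single i 1)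
      rw [PiLp.norm_single, norm_one, mul_one] at h2
      have h3 := h2.trans (hC₂ _)
      have h4 : (fderiv ℝ ζ (R⁻¹ • z.2) (EuclideanSpace.single i 1)) ^ 2 ≤ C₂ ^ 2 :=
        sq_le_sq' (by linarith [neg_abs_le (fderiv ℝ ζ (R⁻¹ • z.2) (EuclideanSpace.single i 1)),
          h3, Real.norm_eq_abs (fderiv ℝ ζ (R⁻¹ • z.2) (EuclideanSpace.single i 1))])
          ((le_abs_self _).trans h3)
      have h5 : η ((R ^ α)⁻¹ • z.1) ^ 2 ≤ 1 := pow_le_one₀ η.nonneg η.le_one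
      have h6 : R ^ (-2 : ℝ) = (R⁻¹) ^ 2 := by
        rw [Real.rpow_neg hR.le]; norm_num
      rw [h6, mul_pow, mul_pow]
      calc _ ≤ 1 * ((R⁻¹) ^ 2 * C₂ ^ 2) := by gcongr
        _ = _ := by ring
    calc _ ≤ ∑ i : Fin n, C₂ ^ 2 * R ^ (-2 : ℝ) := Finset.sum_le_sum fun i _ => h1 i
      _ = n * C₂ ^ 2 * R ^ (-2 : ℝ) := by simp; ring
      _ ≤ _ := by
        gcongr
        nlinarith [abs_nonneg C₁]
  · intro z hz
    rcases hz with hz | hz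
    · refine IsLocalMax.fderiv_eq_zero (Filter.Eventually.of_forall fun y => ?_)
      change _ ≤ (fun z : SpaceTime n => η ((R ^ α)⁻¹ • z.1) * ζ (R⁻¹ • z.2)) z
      simp only
      rw [hone z hz]; exact hle y
    · refine IsLocalMin.fderiv_eq_zero (Filter.Eventually.of_forall fun y => ?_)
      change (fun z : SpaceTime n => η ((R ^ α)⁻¹ • z.1) * ζ (R⁻¹ • z.2)) z ≤ _
      simp only
      rw [hzero z hz]; exact hnn y
  · intro z hz
    rw [hgrad]
    have : fderiv ℝ ζ (R⁻¹ • z.2) = 0 := by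
      apply ContDiffBump.fderiv_eq_zero
      rw [hnorm2, inv_mul_le_iff₀ hR, le_inv_mul_iff₀ hR]
      simp only [ζ]
      by_contra h
      push Not at h
      exact hz ⟨by linarith [h.1], by linarith [h.2]⟩
    ext j
    simp [this]

end Cutoff

/-! ### Limits of integrals and smooth approximating sequences. -/

/-- Split the difference into `(b k - b₀) H(φ k)`, small in `L¹` because `H` is bounded, and `b₀
(H(φ k) - H(u))`, handled by dominated convergence. -/
lemma tendsto_integral_mul_comp {X : Type*} [MeasurableSpace X] {μ : Measure X}
    {b φ : ℕ → X → ℝ} {b₀ u : X → ℝ} {H : ℝ → ℝ} {M : ℝ}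
    (hb : ∀ k, Integrable (b k) μ) (hb₀ : Integrable b₀ μ)
    (h : Tendsto (fun k => ∫⁻ x, ‖b k x - b₀ x‖ₑ ∂μ) atTop (𝓝 0))
    (hφ : ∀ k, AEMeasurable (φ k) μ)
    (hae : ∀ᵐ x ∂μ, Tendsto (fun k => φ k x) atTop (𝓝 (u x)))
    (hH : Continuous H) (hM : ∀ r, |H r| ≤ M) :
    Tendsto (fun k => ∫ x, b k x * H (φ k x) ∂μ) atTop (𝓝 (∫ x, b₀ x * H (u x) ∂μ)) := by
  have hHm : ∀ k, AEStronglyMeasurable (fun x => H (φ k x)) μ := fun k =>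
    (hH.measurable.comp_aemeasurable (hφ k)).aestronglyMeasurable
  have hM' : ∀ k, ∀ᵐ x ∂μ, ‖H (φ k x)‖ ≤ M := fun k => ae_of_all _ fun x => hM _
  have hM0 : 0 ≤ M := (abs_nonneg _).trans (hM 0)
  have h1 : Tendsto (fun k => ∫ x, b₀ x * H (φ k x) ∂μ) atTop
      (𝓝 (∫ x, b₀ x * H (u x) ∂μ)) := by
    refine tendsto_integral_of_dominated_convergence (fun x => ‖b₀ x‖ * M)
      (fun k => hb₀.aestronglyMeasurable.mul (hHm k)) (hb₀.norm.mul_const M)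
      (fun k => ae_of_all _ fun x => ?_) ?_
    · rw [norm_mul]
      exact mul_le_mul_of_nonneg_left (hM _) (norm_nonneg _)
    · filter_upwards [hae] with x hx
      exact ((hH.tendsto _).comp hx).const_mul _
  have h2 : Tendsto (fun k => ∫ x, (b k x - b₀ x) * H (φ k x) ∂μ) atTop (𝓝 0) := by
    have := tendsto_integral_of_L1 (μ := μ) (fun _ => (0 : ℝ))
      aestronglyMeasurable_const
      (F := fun k x => (b k x - b₀ x) * H (φ k x)) (l := atTop)
      (Eventually.of_forall fun k => ((hb k).sub hb₀).mul_bdd (hHm k) (hM' k)) ?_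
    · simpa using this
    · have h3 : Tendsto (fun k => (∫⁻ x, ‖b k x - b₀ x‖ₑ ∂μ) * ENNReal.ofReal M) atTop (𝓝 0) := by
        simpa using ENNReal.Tendsto.mul_const h (Or.inr ENNReal.ofReal_ne_top)
      refine tendsto_of_tendsto_of_tendsto_of_le_of_le tendsto_const_nhds h3
        (fun _ => zero_le) fun k => ?_
      simp only [sub_zero]
      rw [← lintegral_mul_const' _ _ ENNReal.ofReal_ne_top]
      refine lintegral_mono fun x => ?_
      rw [enorm_mul]
      gcongr
      rw [Real.enorm_eq_ofReal_abs]
      exact ENNReal.ofReal_le_ofReal (hM _)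
  have h4 := h2.add h1
  rw [zero_add] at h4
  refine h4.congr fun k => ?_
  have h5 : Integrable (fun x => (b k x - b₀ x) * H (φ k x)) μ :=
    ((hb k).sub hb₀).mul_bdd (hHm k) (hM' k)
  rw [← integral_add h5 (hb₀.mul_bdd (hHm k) (hM' k))]
  refine integral_congr_ae (ae_of_all _ fun x => ?_)
  simp only
  ring

section Approximation

variable {n : ℕ} {a : SpaceTime n → Matrix (Fin n) (Fin n) ℝ} {A : SpaceTime n → ℝ}

lemma aemeasurable_fderiv_apply {Ω : Set (SpaceTime n)} (hΩ : IsOpen Ω) {f : SpaceTime n → ℝ}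
    (hf : ContDiffOn ℝ ∞ f Ω) (v : SpaceTime n) :
    AEMeasurable (fun z => fderiv ℝ f z v) (volume.restrict Ω) := by
  have h : ContinuousOn (fun z => fderiv ℝ f z v) Ω :=
    (hf.continuousOn_fderiv_of_isOpen hΩ (by simp)).clm_apply continuousOn_const
  exact h.aemeasurable hΩ.measurableSet

lemma aemeasurable_spaceGrad {Ω : Set (SpaceTime n)} (hΩ : IsOpen Ω) {f : SpaceTime n → ℝ}
    (hf : ContDiffOn ℝ ∞ f Ω) : AEMeasurable (spaceGrad f) (volume.restrict Ω) :=
  aemeasurable_pi_iff.2 fun _ => aemeasurable_fderiv_apply hΩ hf _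

lemma integrable_of_lintegral_ofReal_lt_top {X : Type*} [MeasurableSpace X] {μ : Measure X}
    {f : X → ℝ} (hm : AEMeasurable f μ) (hf : ∀ᵐ x ∂μ, 0 ≤ f x)
    (h : ∫⁻ x, ENNReal.ofReal (f x) ∂μ < ⊤) : Integrable f μ :=
  ⟨hm.aestronglyMeasurable, (hasFiniteIntegral_iff_ofReal hf).2 h⟩

lemma enorm_rpow_eq (x : ℝ) {q : ℝ} (hq : 0 ≤ q) : ‖x‖ₑ ^ q = ENNReal.ofReal (|x| ^ q) := by
  rw [Real.enorm_eq_ofReal_abs, ENNReal.ofReal_rpow_of_nonneg (abs_nonneg _) hq]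

lemma eLpNorm_eq_of_one_lt {X : Type*} [MeasurableSpace X] {μ : Measure X} (f : X → ℝ) {q : ℝ}
    (hq : 1 < q) : eLpNorm f (ENNReal.ofReal q) μ
      = (∫⁻ x, ENNReal.ofReal (|f x| ^ q) ∂μ) ^ (1 / q) := by
  have hq0 : 0 < q := by linarith
  rw [eLpNorm_eq_lintegral_rpow_enorm_toReal (by simpa using hq0) ENNReal.ofReal_ne_top,
    ENNReal.toReal_ofReal hq0.le]
  simp_rw [enorm_rpow_eq _ hq0.le]

/-- A smooth sequence approximating an element `(u, g, V)` of `W^{𝓛,q}(Ω)`, with convergence in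
all terms of the norm and almost everywhere. -/
structure IsApprox (a : SpaceTime n → Matrix (Fin n) (Fin n) ℝ) (Ω : Set (SpaceTime n))
    (u g : SpaceTime n → ℝ) (V : SpaceTime n → Fin n → ℝ) (φ : ℕ → SpaceTime n → ℝ) : Prop where
  smooth : ∀ k, ContDiffOn ℝ ∞ (φ k) Ω
  integrable : ∀ k, IntegrableOn (φ k) Ω
  integrable_time : ∀ k, IntegrableOn (timeDeriv (φ k)) Ω
  integrable_form : ∀ k, IntegrableOn (fun z => form a z (spaceGrad (φ k) z) (spaceGrad (φ k) z)) Ω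
  tendsto : Tendsto (fun k => ∫⁻ z in Ω, ‖φ k z - u z‖ₑ) atTop (𝓝 0)
  tendsto_time : Tendsto (fun k => ∫⁻ z in Ω, ‖timeDeriv (φ k) z - g z‖ₑ) atTop (𝓝 0)
  tendsto_form : Tendsto (fun k => ∫⁻ z in Ω, ENNReal.ofReal
    (form a z (spaceGrad (φ k) z - V z) (spaceGrad (φ k) z - V z))) atTop (𝓝 0)
  tendsto_ae : ∀ᵐ z ∂volume.restrict Ω, Tendsto (fun k => φ k z) atTop (𝓝 (u z))

lemma tripleNorm_parts {q : ℝ} (hq : 1 < q) (Ω : Set (SpaceTime n)) (w g : SpaceTime n → ℝ)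
    (V : SpaceTime n → Fin n → ℝ) :
    (∫⁻ z in Ω, ENNReal.ofReal |g z|) ≤ tripleNorm a q Ω w g V ∧
    (∫⁻ z in Ω, ENNReal.ofReal (form a z (V z) (V z))) ≤ tripleNorm a q Ω w g V ^ (2 : ℝ) ∧
    eLpNorm w (ENNReal.ofReal q) (volume.restrict Ω) ≤ tripleNorm a q Ω w g V := by
  rw [eLpNorm_eq_of_one_lt _ hq]
  unfold tripleNorm
  rw [max_eq_right hq.le]
  refine ⟨?_, ?_, le_add_self⟩
  · rw [add_assoc]; exact le_self_add
  · calc _ = ((∫⁻ z in Ω, ENNReal.ofReal (form a z (V z) (V z))) ^ (1 / 2 : ℝ)) ^ (2 : ℝ) := by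
          rw [← ENNReal.rpow_mul]; norm_num
      _ ≤ _ := by
          gcongr
          exact le_add_self.trans le_self_add

/-- On a set of finite measure `L^q` convergence gives `L¹` convergence, and a subsequence converges
almost everywhere, as the nonlinear terms require. -/
lemma MemW.exists_isApprox {q : ℝ} (hq : 1 < q) (hL : IsAdmissible a A) {Ω : Set (SpaceTime n)}
    (hΩ : IsOpen Ω) (hfin : volume Ω ≠ ⊤) {u g : SpaceTime n → ℝ} {V : SpaceTime n → Fin n → ℝ}
    (h : MemW a q Ω u g V) :
    IntegrableOn g Ω ∧ IntegrableOn (fun z => form a z (V z) (V z)) Ω ∧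
      IntegrableOn (fun z => |u z| ^ q) Ω ∧ IntegrableOn u Ω ∧ ∃ φ, IsApprox a Ω u g V φ := by
  obtain ⟨hu, hg, hV, φ, hφ, hφfin, hlim⟩ := h
  set μ := volume.restrict Ω with hμ
  have : IsFiniteMeasure μ := ⟨by rw [hμ, Measure.restrict_apply_univ]; exact hfin.lt_top⟩
  have hq0 : 0 < q := by linarith
  have hq1 : (1 : ℝ≥0∞) ≤ ENNReal.ofReal q := by simpa using hq.le
  have hsymm := ae_restrict_of_ae (s := Ω) hL.symm
  have hnn := ae_restrict_of_ae (s := Ω) hL.form_nonneg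
  have hcoeff : ∀ i j, AEMeasurable (fun z => a z i j) μ := fun i j => (hL.coeff_meas i j).restrict
  have hφm : ∀ k, AEMeasurable (φ k) μ := fun k =>
    (hφ k).continuousOn.aemeasurable hΩ.measurableSet
  have hφt : ∀ k, AEMeasurable (timeDeriv (φ k)) μ := fun k => aemeasurable_fderiv_apply hΩ (hφ k) _
  have hφg : ∀ k, AEMeasurable (spaceGrad (φ k)) μ := fun k => aemeasurable_spaceGrad hΩ (hφ k)
  have hlt : ∀ k, Integrable (timeDeriv (φ k)) μ := fun k => by
    refine ⟨(hφt k).aestronglyMeasurable, ?_⟩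
    refine lt_of_le_of_lt ?_ (hφfin k)
    simpa only [Real.enorm_eq_ofReal_abs] using (tripleNorm_parts hq Ω _ _ _).1
  have hlf : ∀ k, Integrable (fun z => form a z (spaceGrad (φ k) z) (spaceGrad (φ k) z)) μ :=
    fun k => by
      refine integrable_of_lintegral_ofReal_lt_top (aemeasurable_form hcoeff (hφg k) (hφg k)) ?_ ?_
      · filter_upwards [hnn] with z hz using hz _
      · exact ((tripleNorm_parts hq Ω _ _ _).2.1).trans_lt
          (ENNReal.rpow_lt_top_of_nonneg (by norm_num) (hφfin k).ne)
  have hlq : ∀ k, MemLp (φ k) (ENNReal.ofReal q) μ := fun k =>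
    ⟨(hφm k).aestronglyMeasurable, ((tripleNorm_parts hq Ω _ _ _).2.2).trans_lt (hφfin k)⟩
  have t1 : Tendsto (fun k => ∫⁻ z, ‖timeDeriv (φ k) z - g z‖ₑ ∂μ) atTop (𝓝 0) := by
    refine tendsto_of_tendsto_of_tendsto_of_le_of_le tendsto_const_nhds hlim
      (fun _ => zero_le) fun k => ?_
    simpa only [Real.enorm_eq_ofReal_abs] using (tripleNorm_parts hq Ω _ _ _).1
  have t2 : Tendsto (fun k => ∫⁻ z, ENNReal.ofReal
      (form a z (spaceGrad (φ k) z - V z) (spaceGrad (φ k) z - V z)) ∂μ) atTop (𝓝 0) := by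
    have h2 := ((ENNReal.continuous_rpow_const (y := 2)).tendsto 0).comp hlim
    rw [ENNReal.zero_rpow_of_pos (by norm_num)] at h2
    exact tendsto_of_tendsto_of_tendsto_of_le_of_le tendsto_const_nhds h2
      (fun _ => zero_le) fun k => (tripleNorm_parts hq Ω _ _ _).2.1
  have t3 : Tendsto (fun k => eLpNorm (φ k - u) (ENNReal.ofReal q) μ) atTop (𝓝 0) :=
    tendsto_of_tendsto_of_tendsto_of_le_of_le tendsto_const_nhds hlim
      (fun _ => zero_le) fun k => (tripleNorm_parts hq Ω _ _ _).2.2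
  have hum : AEStronglyMeasurable u μ := hu.aestronglyMeasurable
  -- One approximant of finite norm at finite distance from `(u, g, V)` suffices for the
  -- integrability of the limit.
  obtain ⟨N, hN1, hN2, hN3⟩ := ((t1.eventually (gt_mem_nhds ENNReal.zero_lt_top)).and
    ((t2.eventually (gt_mem_nhds ENNReal.zero_lt_top)).and
      (t3.eventually (gt_mem_nhds ENNReal.zero_lt_top)))).exists
  have hgi : Integrable g μ := by
    have : Integrable (fun z => timeDeriv (φ N) z - g z) μ :=
      ⟨(hφt N |>.sub hg).aestronglyMeasurable, hN1⟩
    refine ((hlt N).sub this).congr (ae_of_all _ fun z => ?_)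
    simp
  have hVi : Integrable (fun z => form a z (V z) (V z)) μ := by
    have h1 : Integrable (fun z =>
        form a z (spaceGrad (φ N) z - V z) (spaceGrad (φ N) z - V z)) μ := by
      refine integrable_of_lintegral_ofReal_lt_top
        (aemeasurable_form hcoeff ((hφg N).sub hV) ((hφg N).sub hV)) ?_ hN2
      filter_upwards [hnn] with z hz using hz _
    refine (((hlf N).const_mul 2).add (h1.const_mul 2)).mono'
      (aemeasurable_form hcoeff hV hV).aestronglyMeasurable ?_
    filter_upwards [hnn, hsymm] with z hz hs
    rw [Real.norm_of_nonneg (hz _)]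
    exact form_le_two_mul hs hz _ _
  have huq : MemLp u (ENNReal.ofReal q) μ := by
    have h1 : MemLp (φ N - u) (ENNReal.ofReal q) μ :=
      ⟨(hφm N).aestronglyMeasurable.sub hum, hN3⟩
    have h2 := (hlq N).sub h1
    simpa using h2
  have huqi : Integrable (fun z => |u z| ^ q) μ := by
    have := huq.integrable_norm_rpow (by simpa using hq0) ENNReal.ofReal_ne_top
    rwa [ENNReal.toReal_ofReal hq0.le] at this
  obtain ⟨ns, hns, hae⟩ := (tendstoInMeasure_of_tendsto_eLpNorm (by simpa using hq0)
    (fun k => (hφm k).aestronglyMeasurable) hum t3).exists_seq_tendsto_ae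
  have t4 : Tendsto (fun k => ∫⁻ z, ‖φ k z - u z‖ₑ ∂μ) atTop (𝓝 0) := by
    have h1 : Tendsto (fun k => eLpNorm (φ k - u) (ENNReal.ofReal q) μ *
        μ Set.univ ^ (1 / (1 : ℝ≥0∞).toReal - 1 / (ENNReal.ofReal q).toReal)) atTop (𝓝 0) := by
      have := ENNReal.Tendsto.mul_const (b := μ Set.univ ^
        (1 / (1 : ℝ≥0∞).toReal - 1 / (ENNReal.ofReal q).toReal)) t3 (Or.inr ?_)
      · simpa using this
      · refine (ENNReal.rpow_lt_top_of_nonneg ?_ (measure_ne_top _ _)).ne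
        rw [ENNReal.toReal_ofReal hq0.le, ENNReal.toReal_one, sub_nonneg]
        exact one_div_le_one_div_of_le one_pos hq.le
    refine tendsto_of_tendsto_of_tendsto_of_le_of_le tendsto_const_nhds h1
      (fun _ => zero_le) fun k => ?_
    have := eLpNorm_le_eLpNorm_mul_rpow_measure_univ hq1
      ((hφm k).aestronglyMeasurable.sub hum)
    rwa [eLpNorm_one_eq_lintegral_enorm] at this
  exact ⟨hgi, hVi, huqi, huq.integrable hq1, fun k => φ (ns k), fun k => hφ _,
    fun k => (hlq _).integrable hq1, fun k => hlt _, fun k => hlf _,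
    t4.comp hns.tendsto_atTop, t1.comp hns.tendsto_atTop, t2.comp hns.tendsto_atTop, hae⟩

end Approximation

/-! ### Testing the weak inequality with a function of the solution. -/

variable {n : ℕ} {a : SpaceTime n → Matrix (Fin n) (Fin n) ℝ} {A : SpaceTime n → ℝ}

instance : (volume : Measure (SpaceTime n)).IsAddHaarMeasure :=
  inferInstanceAs ((volume : Measure ℝ).prod
    (volume : Measure (EuclideanSpace ℝ (Fin n)))).IsAddHaarMeasure

/-- The approximants are smooth only on `Ω`; off the support of `ψ` the product vanishes identically
nearby, so it is a global test function. -/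
lemma contDiff_mul_of_tsupport_subset {Ω : Set (SpaceTime n)} (hΩ : IsOpen Ω)
    {f ψ : SpaceTime n → ℝ} {m : WithTop ℕ∞} (hf : ContDiffOn ℝ m f Ω) (hψ : ContDiff ℝ m ψ)
    (hs : tsupport ψ ⊆ Ω) : ContDiff ℝ m (fun z => f z * ψ z) := by
  refine contDiff_iff_contDiffAt.2 fun z => ?_
  by_cases hz : z ∈ tsupport ψ
  · exact (hf.contDiffAt (hΩ.mem_nhds (hs hz))).mul hψ.contDiffAt
  · refine (contDiffAt_const (c := (0 : ℝ))).congr_of_eventuallyEq ?_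
    filter_upwards [(isClosed_tsupport ψ).isOpen_compl.mem_nhds hz] with y hy
    rw [image_eq_zero_of_notMem_tsupport hy, mul_zero]

lemma integral_fderiv_apply_eq_zero {P : SpaceTime n → ℝ} (hP : ContDiff ℝ ∞ P)
    (hc : HasCompactSupport P) (v : SpaceTime n) : ∫ z, fderiv ℝ P z v = 0 := by
  have hd : Continuous (fun z => fderiv ℝ P z v) :=
    (hP.continuous_fderiv (by simp)).clm_apply continuous_const
  have h1 : Integrable (fun z => fderiv ℝ P z v) :=
    hd.integrable_of_hasCompactSupport (hc.fderiv_apply (𝕜 := ℝ) v)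
  have h2 : Integrable P := hP.continuous.integrable_of_hasCompactSupport hc
  have := integral_mul_fderiv_eq_neg_fderiv_mul_of_integrable (μ := volume) (𝕜 := ℝ)
    (f := fun _ : SpaceTime n => (1 : ℝ)) (g := P) (v := v) (by simp) (by simpa using h1)
    (by simpa using h2) (fun _ _ => by fun_prop) (fun _ _ => hP.differentiable (by simp) _)
  simpa using this

lemma integrable_bdd_mul_of_integrableOn {Ω : Set (SpaceTime n)} {f ψ : SpaceTime n → ℝ}
    (hf : IntegrableOn f Ω) (hψ : Continuous ψ) (hc : HasCompactSupport ψ) :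
    IntegrableOn (fun z => f z * ψ z) Ω := by
  obtain ⟨C, hC⟩ := hψ.bounded_above_of_compact_support hc
  exact Integrable.mul_bdd hf hψ.aestronglyMeasurable (ae_of_all _ hC)

lemma integrable_add_add {X : Type*} [MeasurableSpace X] {μ : Measure X} {f₁ f₂ f₃ : X → ℝ}
    (h₁ : Integrable f₁ μ) (h₂ : Integrable f₂ μ) (h₃ : Integrable f₃ μ) :
    Integrable (fun x => f₁ x + f₂ x + f₃ x) μ := (h₁.add h₂).add h₃

lemma integral_add_add {X : Type*} [MeasurableSpace X] {μ : Measure X} {f₁ f₂ f₃ : X → ℝ}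
    (h₁ : Integrable f₁ μ) (h₂ : Integrable f₂ μ) (h₃ : Integrable f₃ μ) :
    ∫ x, (f₁ x + f₂ x + f₃ x) ∂μ = ∫ x, f₁ x ∂μ + ∫ x, f₂ x ∂μ + ∫ x, f₃ x ∂μ := by
  rw [← integral_add h₁ h₂]
  exact integral_add (h₁.add h₂) h₃

section Chain

variable {w ψ : SpaceTime n → ℝ} {F F' G : ℝ → ℝ} {z : SpaceTime n}

lemma fderiv_comp_mul (hw : DifferentiableAt ℝ w z) (hψ : DifferentiableAt ℝ ψ z)
    (hd : HasDerivAt F (F' (w z)) (w z)) (v : SpaceTime n) :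
    fderiv ℝ (fun z => F (w z) * ψ z) z v
      = F' (w z) * ψ z * fderiv ℝ w z v + F (w z) * fderiv ℝ ψ z v := by
  have h1 : HasFDerivAt (fun z => F (w z)) (F' (w z) • fderiv ℝ w z) z :=
    hd.comp_hasFDerivAt z hw.hasFDerivAt
  have h2 : HasFDerivAt (fun z => F (w z) * ψ z)
      (F (w z) • fderiv ℝ ψ z + ψ z • F' (w z) • fderiv ℝ w z) z := h1.mul hψ.hasFDerivAt
  rw [h2.fderiv]
  simp only [add_apply, smul_apply, smul_eq_mul]
  ring

end Chain

lemma integrableOn_form_of_integrableOn (hL : IsAdmissible a A) {Ω : Set (SpaceTime n)}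
    {ξ η : SpaceTime n → Fin n → ℝ} (hξ : AEMeasurable ξ (volume.restrict Ω))
    (hη : AEMeasurable η (volume.restrict Ω))
    (h1 : IntegrableOn (fun z => form a z (ξ z) (ξ z)) Ω)
    (h2 : IntegrableOn (fun z => form a z (η z) (η z)) Ω) :
    IntegrableOn (fun z => form a z (ξ z) (η z)) Ω := by
  refine Integrable.mono' ((h1.add h2).div_const 2) (aemeasurable_form
    (fun i j => (hL.coeff_meas i j).restrict) hξ hη).aestronglyMeasurable ?_
  filter_upwards [ae_restrict_of_ae hL.symm, ae_restrict_of_ae hL.form_nonneg] with z hs hp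
  exact abs_form_le_half hs hp _ _

lemma integrableOn_form_spaceGrad (hL : IsAdmissible a A) {Ω : Set (SpaceTime n)}
    (hΩ : Bornology.IsBounded Ω) (hm : MeasurableSet Ω) {ψ : SpaceTime n → ℝ}
    (hψ : ContDiff ℝ ∞ ψ) :
    IntegrableOn (fun z => form a z (spaceGrad ψ z) (spaceGrad ψ z)) Ω := by
  have hcont : ∀ i, Continuous (fun z => spaceGrad ψ z i) := fun i =>
    (hψ.continuous_fderiv (by simp)).clm_apply continuous_const
  have hfin : volume Ω ≠ ⊤ := hΩ.measure_lt_top.ne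
  have hmeas : AEMeasurable (fun z => form a z (spaceGrad ψ z) (spaceGrad ψ z))
      (volume.restrict Ω) :=
    aemeasurable_form (fun i j => (hL.coeff_meas i j).restrict)
      (aemeasurable_pi_iff.2 fun i => (hcont i).aemeasurable)
      (aemeasurable_pi_iff.2 fun i => (hcont i).aemeasurable)
  obtain ⟨M, hM⟩ := hL.bound_bdd _ hΩ.isCompact_closure
  obtain ⟨C, hC⟩ := hΩ.isCompact_closure.exists_bound_of_continuousOn
    (f := fun z => ∑ i, spaceGrad ψ z i ^ 2)
    (continuous_finsetSum _ fun i _ => (hcont i).pow 2).continuousOn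
  have : IsFiniteMeasure (volume.restrict Ω) :=
    ⟨by rw [Measure.restrict_apply_univ]; exact hfin.lt_top⟩
  refine Integrable.of_bound hmeas.aestronglyMeasurable (M * C) ?_
  filter_upwards [ae_restrict_of_ae hL.form_le, ae_restrict_of_ae hL.form_nonneg,
    ae_restrict_mem hm] with z hle hp hz
  rw [Real.norm_of_nonneg (hp _)]
  refine (hle _).trans ?_
  have hz' := subset_closure hz
  have h1 := (le_abs_self _).trans (hM z hz')
  have h2 := (le_abs_self _).trans (hC z hz')
  exact mul_le_mul h1 h2 (Finset.sum_nonneg fun i _ => sq_nonneg _)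
    ((hL.bound_nonneg z).trans h1)

lemma rpow_sub_one_mul_self {q : ℝ} (hq : 1 < q) {x : ℝ} (hx : 0 ≤ x) :
    |x| ^ (q - 1) * x = |x| ^ q := by
  rw [abs_of_nonneg hx]
  rcases hx.eq_or_lt with h | h
  · rw [← h, Real.zero_rpow (by linarith : q - 1 ≠ 0), Real.zero_rpow (by linarith : q ≠ 0), zero_mul]
  · rw [Real.rpow_sub_one h.ne', div_mul_cancel₀ _ h.ne']

/-- The weak inequality tested with `F(u) ψ`. -/
lemma weak_inequality_comp {q : ℝ} (hq : 1 < q) (hL : IsAdmissible a A)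
    {u g : SpaceTime n → ℝ} {V : SpaceTime n → Fin n → ℝ} (hum : AEMeasurable u volume)
    (hu0 : ∀ᵐ z, 0 ≤ u z) (hW : MemWLoc a q u g V)
    (hweak : ∀ φ : SpaceTime n → ℝ, ContDiff ℝ ∞ φ → HasCompactSupport φ → (∀ z, 0 ≤ φ z) →
      0 ≤ ∫ z, (g z * φ z + form a z (spaceGrad φ z) (V z) - |u z| ^ (q - 1) * u z * φ z))
    {F F' G : ℝ → ℝ} {M : ℝ} (hF : ContDiff ℝ ∞ F) (hF' : Continuous F')
    (hFd : ∀ r, HasDerivAt F (F' r) r) (hF0 : ∀ r, 0 ≤ F r) (hFM : ∀ r, |F r| ≤ M)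
    (hFM' : ∀ r, |F' r| ≤ M) (hG : ContDiff ℝ ∞ G) (hGd : ∀ r, HasDerivAt G (F r) r)
    (hGl : ∀ r s, |G r - G s| ≤ M * |r - s|)
    {ψ : SpaceTime n → ℝ} (hψ : ContDiff ℝ ∞ ψ) (hc : HasCompactSupport ψ) (hψ0 : ∀ z, 0 ≤ ψ z) :
    Integrable (fun z => |u z| ^ q * ψ z) ∧
    Integrable (fun z => |u z| ^ q * ψ z * F (u z)) ∧
    Integrable (fun z => -(timeDeriv ψ z * G (u z))
      + ψ z * form a z (V z) (V z) * F' (u z) + form a z (spaceGrad ψ z) (V z) * F (u z)) ∧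
    ∫ z, |u z| ^ q * ψ z * F (u z) ≤ ∫ z, (-(timeDeriv ψ z * G (u z))
      + ψ z * form a z (V z) (V z) * F' (u z) + form a z (spaceGrad ψ z) (V z) * F (u z)) := by
  obtain ⟨ρ, hρ0, hρ⟩ : ∃ ρ : ℝ, 0 < ρ ∧ tsupport ψ ⊆ Metric.ball 0 ρ := by
    obtain ⟨ρ, hρ⟩ := hc.isCompact.isBounded.subset_ball (0 : SpaceTime n)
    exact ⟨max ρ 1, by positivity, hρ.trans (Metric.ball_subset_ball (le_max_left _ _))⟩
  set Ω : Set (SpaceTime n) := Metric.ball 0 ρ with hΩdef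
  have hΩ : IsOpen Ω := Metric.isOpen_ball
  have hΩm : MeasurableSet Ω := hΩ.measurableSet
  have hΩb : Bornology.IsBounded Ω := Metric.isBounded_ball
  have hWΩ := hW Ω hΩ ⟨⟨0, Metric.mem_ball_self hρ0⟩, (convex_ball _ _).isPreconnected⟩ hΩb
  have hVm : AEMeasurable V (volume.restrict Ω) := hWΩ.2.2.1
  have hgm : AEMeasurable g (volume.restrict Ω) := hWΩ.2.1
  obtain ⟨hgi, hVi, huq, hui, φ, hφ⟩ := hWΩ.exists_isApprox hq hL hΩ hΩb.measure_lt_top.ne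
  have hψout : ∀ z ∉ Ω, ψ z = 0 := fun z hz => image_eq_zero_of_notMem_tsupport fun h => hz (hρ h)
  have hdout : ∀ z ∉ Ω, fderiv ℝ ψ z = 0 := fun z hz =>
    image_eq_zero_of_notMem_tsupport fun h => hz (hρ (tsupport_fderiv_subset ℝ h))
  have hgout : ∀ z ∉ Ω, spaceGrad ψ z = 0 := fun z hz => by
    ext i; simp [spaceGrad, hdout z hz]
  have htout : ∀ z ∉ Ω, timeDeriv ψ z = 0 := fun z hz => by simp [timeDeriv, hdout z hz]
  have hφm : ∀ k, AEMeasurable (φ k) (volume.restrict Ω) := fun k =>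
    (hφ.smooth k).continuousOn.aemeasurable hΩm
  have hφg : ∀ k, AEMeasurable (spaceGrad (φ k)) (volume.restrict Ω) := fun k =>
    aemeasurable_spaceGrad hΩ (hφ.smooth k)
  have hψg : AEMeasurable (spaceGrad ψ) (volume.restrict Ω) :=
    aemeasurable_spaceGrad hΩ hψ.contDiffOn
  have hψt : Continuous (timeDeriv ψ) :=
    (hψ.continuous_fderiv (by simp)).clm_apply continuous_const
  have hψtc : HasCompactSupport (timeDeriv ψ) := hc.fderiv_apply (𝕜 := ℝ) _
  obtain ⟨Cψ, hCψ⟩ := hψ.continuous.bounded_above_of_compact_support hc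
  obtain ⟨Ct, hCt⟩ := hψt.bounded_above_of_compact_support hψtc
  have hCψ0 : 0 ≤ Cψ := (norm_nonneg _).trans (hCψ 0)
  -- integrability of the coefficients
  have i1 : IntegrableOn (fun z => g z * ψ z) Ω :=
    integrable_bdd_mul_of_integrableOn hgi hψ.continuous hc
  have i1k : ∀ k, IntegrableOn (fun z => timeDeriv (φ k) z * ψ z) Ω := fun k =>
    integrable_bdd_mul_of_integrableOn (hφ.integrable_time k) hψ.continuous hc
  have i2 : IntegrableOn (fun z => form a z (V z) (V z) * ψ z) Ω :=
    integrable_bdd_mul_of_integrableOn hVi hψ.continuous hc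
  have i2k : ∀ k, IntegrableOn (fun z => form a z (spaceGrad (φ k) z) (V z) * ψ z) Ω := fun k =>
    integrable_bdd_mul_of_integrableOn (integrableOn_form_of_integrableOn hL (hφg k) hVm
      (hφ.integrable_form k) hVi) hψ.continuous hc
  have i3 : IntegrableOn (fun z => form a z (spaceGrad ψ z) (V z)) Ω :=
    integrableOn_form_of_integrableOn hL hψg hVm
      (integrableOn_form_spaceGrad hL hΩb hΩm hψ) hVi
  have i4 : IntegrableOn (fun z => |u z| ^ q * ψ z) Ω :=
    integrable_bdd_mul_of_integrableOn huq hψ.continuous hc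
  have hGc : Continuous G := hG.continuous
  have hGint : ∀ w : SpaceTime n → ℝ, IntegrableOn w Ω → AEMeasurable w (volume.restrict Ω) →
      IntegrableOn (fun z => timeDeriv ψ z * G (w z)) Ω := by
    intro w hw hwm
    have h1 : IntegrableOn (fun z => G (w z)) Ω := by
      have h2 : IntegrableOn (fun z => M * |w z| + |G 0|) Ω :=
        (hw.abs.const_mul M).add (integrableOn_const hΩb.measure_lt_top.ne)
      refine Integrable.mono' h2 (hGc.measurable.comp_aemeasurable hwm).aestronglyMeasurable
        (ae_of_all _ fun z => ?_)
      have h3 := hGl (w z) 0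
      rw [sub_zero] at h3
      rw [Real.norm_eq_abs]
      calc |G (w z)| = |(G (w z) - G 0) + G 0| := by ring_nf
        _ ≤ |G (w z) - G 0| + |G 0| := abs_add_le _ _
        _ ≤ _ := by gcongr
    exact Integrable.bdd_mul h1 hψt.aestronglyMeasurable (ae_of_all _ hCt)
  have hcompF : ∀ w : SpaceTime n → ℝ, AEMeasurable w (volume.restrict Ω) →
      AEStronglyMeasurable (fun z => F (w z)) (volume.restrict Ω) := fun w hw =>
    (hF.continuous.measurable.comp_aemeasurable hw).aestronglyMeasurable
  have hcompF' : ∀ w : SpaceTime n → ℝ, AEMeasurable w (volume.restrict Ω) →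
      AEStronglyMeasurable (fun z => F' (w z)) (volume.restrict Ω) := fun w hw =>
    (hF'.measurable.comp_aemeasurable hw).aestronglyMeasurable
  -- the limits
  have l0 : Tendsto (fun k => ∫ z in Ω, timeDeriv ψ z * G (φ k z)) atTop
      (𝓝 (∫ z in Ω, timeDeriv ψ z * G (u z))) := by
    refine tendsto_integral_of_L1 _ (hGint u hui hum.restrict).aestronglyMeasurable
      (Eventually.of_forall fun k => hGint _ (hφ.integrable k) (hφm k)) ?_
    have h1 : Tendsto (fun k => ENNReal.ofReal (Ct * M) * ∫⁻ z in Ω, ‖φ k z - u z‖ₑ)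
        atTop (𝓝 0) := by
      simpa using ENNReal.Tendsto.const_mul (a := ENNReal.ofReal (Ct * M)) hφ.tendsto
        (Or.inr ENNReal.ofReal_ne_top)
    refine tendsto_of_tendsto_of_tendsto_of_le_of_le tendsto_const_nhds h1
      (fun _ => zero_le) fun k => ?_
    simp only
    rw [← lintegral_const_mul' _ _ ENNReal.ofReal_ne_top]
    refine lintegral_mono fun z => ?_
    have hCt0 : 0 ≤ Ct := (norm_nonneg _).trans (hCt z)
    rw [Real.enorm_eq_ofReal_abs, Real.enorm_eq_ofReal_abs, ← ENNReal.ofReal_mul'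
      (abs_nonneg _)]
    apply ENNReal.ofReal_le_ofReal
    rw [← mul_sub, abs_mul, mul_assoc]
    exact mul_le_mul (hCt z) (hGl _ _) (abs_nonneg _) hCt0
  have hmulψ : ∀ b : ℕ → SpaceTime n → ℝ, ∀ b₀ : SpaceTime n → ℝ,
      Tendsto (fun k => ∫⁻ z in Ω, ‖b k z - b₀ z‖ₑ) atTop (𝓝 0) →
      Tendsto (fun k => ∫⁻ z in Ω, ‖b k z * ψ z - b₀ z * ψ z‖ₑ) atTop (𝓝 0) := by
    intro b b₀ h
    have h1 : Tendsto (fun k => (∫⁻ z in Ω, ‖b k z - b₀ z‖ₑ) * ENNReal.ofReal Cψ)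
        atTop (𝓝 0) := by
      simpa using ENNReal.Tendsto.mul_const (b := ENNReal.ofReal Cψ) h
        (Or.inr ENNReal.ofReal_ne_top)
    refine tendsto_of_tendsto_of_tendsto_of_le_of_le tendsto_const_nhds h1
      (fun _ => zero_le) fun k => ?_
    simp only
    rw [← lintegral_mul_const' _ _ ENNReal.ofReal_ne_top]
    refine lintegral_mono fun z => ?_
    rw [← sub_mul, enorm_mul]
    gcongr
    rw [Real.enorm_eq_ofReal_abs]
    exact ENNReal.ofReal_le_ofReal (hCψ z)
  have l1 : Tendsto (fun k => ∫ z in Ω, timeDeriv (φ k) z * ψ z * F (φ k z)) atTop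
      (𝓝 (∫ z in Ω, g z * ψ z * F (u z))) :=
    tendsto_integral_mul_comp i1k i1 (hmulψ _ _ hφ.tendsto_time) hφm hφ.tendsto_ae
      hF.continuous hFM
  -- The weak inequality contains `g`, whereas integration by parts needs the classical derivative
  -- of `φ k`; `l1` and `l1'` share their limit, which links the two.
  have l1' : Tendsto (fun k => ∫ z in Ω, g z * ψ z * F (φ k z)) atTop
      (𝓝 (∫ z in Ω, g z * ψ z * F (u z))) :=
    tendsto_integral_mul_comp (fun _ => i1) i1 (by simp) hφm hφ.tendsto_ae hF.continuous hFM
  -- Only one slot of the form varies, so Cauchy–Schwarz with the finite energy of `V` yields `L¹`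
  -- convergence of the coefficient.
  have l2 : Tendsto (fun k => ∫ z in Ω, form a z (spaceGrad (φ k) z) (V z) * ψ z * F' (φ k z))
      atTop (𝓝 (∫ z in Ω, form a z (V z) (V z) * ψ z * F' (u z))) := by
    refine tendsto_integral_mul_comp i2k i2 (hmulψ (fun k z => form a z (spaceGrad (φ k) z) (V z))
      (fun z => form a z (V z) (V z)) ?_) hφm hφ.tendsto_ae hF' hFM'
    have hVfin : ∫⁻ z in Ω, ENNReal.ofReal (form a z (V z) (V z)) ≠ ⊤ := by
      refine ((hasFiniteIntegral_iff_ofReal ?_).1 hVi.hasFiniteIntegral).ne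
      filter_upwards [ae_restrict_of_ae hL.form_nonneg] with z hz using hz _
    have h1 : Tendsto (fun k => (∫⁻ z in Ω, ENNReal.ofReal
        (form a z (spaceGrad (φ k) z - V z) (spaceGrad (φ k) z - V z))) ^ (1 / 2 : ℝ)
        * (∫⁻ z in Ω, ENNReal.ofReal (form a z (V z) (V z))) ^ (1 / 2 : ℝ)) atTop (𝓝 0) := by
      have h2 := ((ENNReal.continuous_rpow_const (y := 1 / 2)).tendsto 0).comp hφ.tendsto_form
      rw [ENNReal.zero_rpow_of_pos (by norm_num)] at h2
      have h3 := ENNReal.Tendsto.mul_const (b := (∫⁻ z in Ω, ENNReal.ofReal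
        (form a z (V z) (V z))) ^ (1 / 2 : ℝ)) h2
        (Or.inr (ENNReal.rpow_lt_top_of_nonneg (by norm_num) hVfin).ne)
      rwa [zero_mul] at h3
    refine tendsto_of_tendsto_of_tendsto_of_le_of_le tendsto_const_nhds h1
      (fun _ => zero_le) fun k => ?_
    have hcoeff : ∀ i j, AEMeasurable (fun z => a z i j) (volume.restrict Ω) := fun i j =>
      (hL.coeff_meas i j).restrict
    have h4 := ENNReal.lintegral_mul_le_Lp_mul_Lq (volume.restrict Ω) Real.HolderConjugate.two_two
      (f := fun z => ENNReal.ofReal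
        (form a z (spaceGrad (φ k) z - V z) (spaceGrad (φ k) z - V z)) ^ (1 / 2 : ℝ))
      (g := fun z => ENNReal.ofReal (form a z (V z) (V z)) ^ (1 / 2 : ℝ))
      ((aemeasurable_form hcoeff ((hφg k).sub hVm) ((hφg k).sub hVm)).ennreal_ofReal.pow_const _)
      ((aemeasurable_form hcoeff hVm hVm).ennreal_ofReal.pow_const _)
    simp only [← ENNReal.rpow_mul, one_div, inv_mul_cancel₀ (two_ne_zero' ℝ),
      ENNReal.rpow_one] at h4
    simp only [one_div]
    refine le_trans (lintegral_mono_ae ?_) h4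
    filter_upwards [ae_restrict_of_ae hL.symm, ae_restrict_of_ae hL.form_nonneg] with z hs hp
    have h5 := enorm_form_le hs hp (spaceGrad (φ k) z - V z) (V z)
    have h6 := form_linear_left (a := a) (z := z) 1 (-1) (spaceGrad (φ k) z) (V z) (V z)
    rw [one_smul, neg_one_smul, ← sub_eq_add_neg] at h6
    rw [h6] at h5
    simpa [one_div, ← sub_eq_add_neg] using h5
  have l3 : Tendsto (fun k => ∫ z in Ω, form a z (spaceGrad ψ z) (V z) * F (φ k z)) atTop
      (𝓝 (∫ z in Ω, form a z (spaceGrad ψ z) (V z) * F (u z))) :=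
    tendsto_integral_mul_comp (fun _ => i3) i3 (by simp) hφm hφ.tendsto_ae hF.continuous hFM
  have l4 : Tendsto (fun k => ∫ z in Ω, |u z| ^ q * ψ z * F (φ k z)) atTop
      (𝓝 (∫ z in Ω, |u z| ^ q * ψ z * F (u z))) :=
    tendsto_integral_mul_comp (fun _ => i4) i4 (by simp) hφm hφ.tendsto_ae hF.continuous hFM
  -- integration by parts in time
  have parts : ∀ k, ∫ z in Ω, timeDeriv (φ k) z * ψ z * F (φ k z)
      = -∫ z in Ω, timeDeriv ψ z * G (φ k z) := by
    intro k
    have hP : ContDiff ℝ ∞ (fun z => G (φ k z) * ψ z) :=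
      contDiff_mul_of_tsupport_subset hΩ (hG.comp_contDiffOn (hφ.smooth k)) hψ hρ
    have h1 := integral_fderiv_apply_eq_zero hP hc.mul_left (1, 0)
    have h2 : ∀ z ∉ Ω, fderiv ℝ (fun z => G (φ k z) * ψ z) z (1, 0) = 0 := by
      intro z hz
      have : fderiv ℝ (fun z => G (φ k z) * ψ z) z = 0 :=
        image_eq_zero_of_notMem_tsupport fun h =>
          hz (hρ (tsupport_mul_subset_right (tsupport_fderiv_subset ℝ h)))
      rw [this]; rfl
    rw [← setIntegral_eq_integral_of_forall_compl_eq_zero h2] at h1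
    have h3 : ∫ z in Ω, (timeDeriv (φ k) z * ψ z * F (φ k z) + timeDeriv ψ z * G (φ k z)) = 0 := by
      rw [← h1]
      refine setIntegral_congr_fun hΩm fun z hz => ?_
      rw [fderiv_comp_mul (F := G) (F' := F)
        (((hφ.smooth k).contDiffAt (hΩ.mem_nhds hz)).differentiableAt (by simp))
        (hψ.differentiable (by simp) z) (hGd _)]
      simp only [timeDeriv]
      ring
    rw [integral_add ((i1k k).mul_bdd (hcompF _ (hφm k)) (ae_of_all _ fun z => hFM _))
      (hGint _ (hφ.integrable k) (hφm k))] at h3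
    linarith
  -- The weak inequality for the test function `F(φ k) ψ`. The sign of `u` serves to turn `|u|^(q-1)
  -- u` into `|u|^q`.
  have ineq : ∀ k, 0 ≤ (∫ z in Ω, g z * ψ z * F (φ k z))
      + (∫ z in Ω, form a z (spaceGrad (φ k) z) (V z) * ψ z * F' (φ k z))
      + (∫ z in Ω, form a z (spaceGrad ψ z) (V z) * F (φ k z))
      - ∫ z in Ω, |u z| ^ q * ψ z * F (φ k z) := by
    intro k
    have hP : ContDiff ℝ ∞ (fun z => F (φ k z) * ψ z) :=
      contDiff_mul_of_tsupport_subset hΩ (hF.comp_contDiffOn (hφ.smooth k)) hψ hρ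
    have h1 := hweak _ hP hc.mul_left fun z => mul_nonneg (hF0 _) (hψ0 z)
    have h2 : ∀ z ∉ Ω, g z * (F (φ k z) * ψ z)
        + form a z (spaceGrad (fun z => F (φ k z) * ψ z) z) (V z)
        - |u z| ^ (q - 1) * u z * (F (φ k z) * ψ z) = 0 := by
      intro z hz
      have : fderiv ℝ (fun z => F (φ k z) * ψ z) z = 0 :=
        image_eq_zero_of_notMem_tsupport fun h =>
          hz (hρ (tsupport_mul_subset_right (tsupport_fderiv_subset ℝ h)))
      simp [spaceGrad, this, hψout z hz, form]
    rw [← setIntegral_eq_integral_of_forall_compl_eq_zero h2] at h1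
    refine h1.trans_eq ?_
    have b1 := i1.mul_bdd (hcompF _ (hφm k)) (ae_of_all _ fun z => hFM (φ k z))
    have b2 := (i2k k).mul_bdd (hcompF' _ (hφm k)) (ae_of_all _ fun z => hFM' (φ k z))
    have b3 := i3.mul_bdd (hcompF _ (hφm k)) (ae_of_all _ fun z => hFM (φ k z))
    have b4 := i4.mul_bdd (hcompF _ (hφm k)) (ae_of_all _ fun z => hFM (φ k z))
    rw [← integral_add_add b1 b2 b3, ← integral_sub (integrable_add_add b1 b2 b3) b4]
    refine integral_congr_ae ?_
    filter_upwards [ae_restrict_mem hΩm, ae_restrict_of_ae hu0] with z hz huz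
    have hgr : spaceGrad (fun z => F (φ k z) * ψ z) z
        = (F' (φ k z) * ψ z) • spaceGrad (φ k) z + F (φ k z) • spaceGrad ψ z := by
      ext i
      simp only [spaceGrad, Pi.add_apply, Pi.smul_apply, smul_eq_mul]
      exact fderiv_comp_mul (((hφ.smooth k).contDiffAt (hΩ.mem_nhds hz)).differentiableAt
        (by simp)) (hψ.differentiable (by simp) z) (hFd _) _
    rw [hgr, form_linear_left, rpow_sub_one_mul_self hq huz]
    ring
  have hlim := ge_of_tendsto' (((l1'.add l2).add l3).sub l4) ineq
  have hparts : ∫ z in Ω, g z * ψ z * F (u z) = -∫ z in Ω, timeDeriv ψ z * G (u z) := by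
    refine tendsto_nhds_unique l1 (l0.neg.congr fun k => ?_)
    rw [parts]
  have humΩ : AEMeasurable u (volume.restrict Ω) := hum.restrict
  have b0 := hGint u hui humΩ
  have b2 := i2.mul_bdd (hcompF' u humΩ) (ae_of_all _ fun z => hFM' (u z))
  have b3 := i3.mul_bdd (hcompF u humΩ) (ae_of_all _ fun z => hFM (u z))
  have b4 := i4.mul_bdd (hcompF u humΩ) (ae_of_all _ fun z => hFM (u z))
  have s4 : ∀ z ∉ Ω, |u z| ^ q * ψ z * F (u z) = 0 := fun z hz => by simp [hψout z hz]
  have s5 : ∀ z ∉ Ω, -(timeDeriv ψ z * G (u z)) + ψ z * form a z (V z) (V z) * F' (u z)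
      + form a z (spaceGrad ψ z) (V z) * F (u z) = 0 := fun z hz => by
    simp [hψout z hz, hgout z hz, htout z hz, form]
  have b5 : IntegrableOn (fun z => -(timeDeriv ψ z * G (u z))
      + ψ z * form a z (V z) (V z) * F' (u z) + form a z (spaceGrad ψ z) (V z) * F (u z)) Ω := by
    refine (((b0.neg.add b2).add b3).congr (ae_of_all _ fun z => ?_))
    simp only [Pi.add_apply, Pi.neg_apply]
    ring
  refine ⟨?_, ?_, ?_, ?_⟩
  · refine (integrableOn_iff_integrable_of_support_subset fun z hz => ?_).1 i4
    by_contra h; exact hz (by simp [hψout z h])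
  · refine (integrableOn_iff_integrable_of_support_subset fun z hz => ?_).1 b4
    by_contra h; exact hz (s4 z h)
  · refine (integrableOn_iff_integrable_of_support_subset fun z hz => ?_).1 b5
    by_contra h; exact hz (s5 z h)
  · rw [← setIntegral_eq_integral_of_forall_compl_eq_zero s4,
      ← setIntegral_eq_integral_of_forall_compl_eq_zero s5]
    have e : ∫ z in Ω, (-(timeDeriv ψ z * G (u z)) + ψ z * form a z (V z) (V z) * F' (u z)
        + form a z (spaceGrad ψ z) (V z) * F (u z))
        = -(∫ z in Ω, timeDeriv ψ z * G (u z))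
          + (∫ z in Ω, form a z (V z) (V z) * ψ z * F' (u z))
          + ∫ z in Ω, form a z (spaceGrad ψ z) (V z) * F (u z) := by
      have b0n : Integrable (fun z => -(timeDeriv ψ z * G (u z))) (volume.restrict Ω) := b0.neg
      rw [← integral_neg, ← integral_add_add b0n b2 b3]
      refine integral_congr_ae (ae_of_all _ fun z => ?_)
      ring
    rw [e, ← hparts]
    linarith

/-! ### The weighted energy estimate. -/

lemma integral_rpow_le {X : Type*} [MeasurableSpace X] {μ : Measure X} [IsFiniteMeasure μ]
    {w : X → ℝ} (hw : Integrable w μ) (h0 : ∀ x, 0 ≤ w x) {r : ℝ} (hr0 : 0 < r) (hr1 : r < 1) :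
    Integrable (fun x => w x ^ r) μ ∧
      ∫ x, w x ^ r ∂μ ≤ (∫ x, w x ∂μ) ^ r * μ.real Set.univ ^ (1 - r) := by
  have hm : AEStronglyMeasurable (fun x => w x ^ r) μ :=
    (hw.aestronglyMeasurable.aemeasurable.pow_const r).aestronglyMeasurable
  have hrpos : 0 < 1 / r := by positivity
  have hL : MemLp (fun x => w x ^ r) (ENNReal.ofReal (1 / r)) μ := by
    rw [← integrable_norm_rpow_iff hm (by simpa using hr0) ENNReal.ofReal_ne_top]
    refine hw.congr (ae_of_all _ fun x => ?_)
    simp only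
    rw [ENNReal.toReal_ofReal hrpos.le, Real.norm_of_nonneg (Real.rpow_nonneg (h0 x) _),
      ← Real.rpow_mul (h0 x), mul_one_div_cancel hr0.ne', Real.rpow_one]
  have hconj : (1 / r).HolderConjugate (1 / (1 - r)) := by
    rw [Real.holderConjugate_iff]
    refine ⟨by rw [lt_div_iff₀ hr0]; linarith, by simp⟩
  have hi : Integrable (fun x => w x ^ r) μ := by
    refine hL.integrable ?_
    rw [ENNReal.one_le_ofReal, le_div_iff₀ hr0]; linarith
  refine ⟨hi, ?_⟩
  have := integral_mul_le_Lp_mul_Lq_of_nonneg hconj (μ := μ) (f := fun x => w x ^ r)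
    (g := fun _ => (1 : ℝ)) (ae_of_all _ fun x => Real.rpow_nonneg (h0 x) _)
    (ae_of_all _ fun _ => zero_le_one) hL (memLp_const 1)
  have e : ∀ x, (w x ^ r) ^ (1 / r) = w x := fun x => by
    rw [← Real.rpow_mul (h0 x), mul_one_div_cancel hr0.ne', Real.rpow_one]
  simp only [e, one_div_one_div, mul_one, Real.one_rpow, integral_const, smul_eq_mul] at this
  exact this

/-- As `0 ≤ y ≤ 1`, lowering the exponent of `y` to `N r / q ≤ m` only increases the power. A high
power of the cutoff thus survives the loss of derivatives. -/
lemma pow_mul_rpow_le {x y q r : ℝ} (hx : 0 ≤ x) (hy : 0 ≤ y) (hy1 : y ≤ 1) (hq : 0 < q)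
    (hr : 0 ≤ r) {N m : ℕ} (h : N * r ≤ q * m) :
    y ^ m * x ^ r ≤ (x ^ q * y ^ N) ^ (r / q) := by
  have h1 : (N : ℝ) * (r / q) ≤ m := by
    rw [← mul_div_assoc, div_le_iff₀ hq]; linarith
  rw [Real.mul_rpow (by positivity) (by positivity), ← Real.rpow_mul hx,
    mul_div_cancel₀ _ hq.ne', ← Real.rpow_natCast y N, ← Real.rpow_mul hy, mul_comm,
    ← Real.rpow_natCast y m]
  exact mul_le_mul_of_nonneg_left
    (Real.rpow_le_rpow_of_exponent_ge' hy hy1 (by positivity) h1) (by positivity)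

lemma fderiv_pow_succ {χ : SpaceTime n → ℝ} {z : SpaceTime n} (h : DifferentiableAt ℝ χ z)
    (m : ℕ) : fderiv ℝ (fun z => χ z ^ (m + 1)) z = ((m + 1 : ℕ) * χ z ^ m) • fderiv ℝ χ z := by
  have := (h.hasFDerivAt.pow (m + 1)).fderiv
  simpa using this

lemma ae_le_of_annulusSup_le {R B : ℝ} (hB : 0 ≤ B) (h : annulusSup A R ≤ ENNReal.ofReal B) :
    ∀ᵐ z : SpaceTime n, (R / 2 < ‖z.2‖ ∧ ‖z.2‖ < R) → A z ≤ B := by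
  have hm : MeasurableSet {z : SpaceTime n | R / 2 < ‖z.2‖ ∧ ‖z.2‖ < R} :=
    (measurableSet_lt measurable_const measurable_snd.norm).inter
      (measurableSet_lt measurable_snd.norm measurable_const)
  have h1 := ENNReal.ae_le_essSup (μ := volume.restrict
    {z : SpaceTime n | R / 2 < ‖z.2‖ ∧ ‖z.2‖ < R}) (fun z => ENNReal.ofReal (A z))
  rw [ae_restrict_iff' hm] at h1
  filter_upwards [h1] with z hz hzm
  exact (ENNReal.ofReal_le_ofReal_iff hB).1 ((hz hzm).trans h)

/-- The volume factor from Hölder contributes `R ^ (N (1 - r))`, which the prefactor `R ^ e`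
compensates; `1 ≤ C` allows `C ^ (1 - r) ≤ C`. -/
lemma rpow_scaling_bound {C R e s : ℝ} (hC : 1 ≤ C) (hR : 1 < R) {Y V r N : ℝ} (hY : 0 ≤ Y)
    (hV0 : 0 ≤ V) (hV : V ≤ C * R ^ N) (hr1 : r < 1) (hr0 : 0 < r)
    (hs : 0 ≤ s) (he : e + N * (1 - r) ≤ 0) :
    R ^ e * (s * (Y ^ r * V ^ (1 - r))) ≤ C * (s * Y ^ r) := by
  have hRp : 0 < R := by linarith
  have h1 : V ^ (1 - r) ≤ C * R ^ (N * (1 - r)) := by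
    calc V ^ (1 - r) ≤ (C * R ^ N) ^ (1 - r) := Real.rpow_le_rpow hV0 hV (by linarith)
      _ = C ^ (1 - r) * R ^ (N * (1 - r)) := by
        rw [Real.mul_rpow (by linarith) (by positivity), ← Real.rpow_mul hRp.le]
      _ ≤ _ := by
        gcongr
        calc C ^ (1 - r) ≤ C ^ (1 : ℝ) := Real.rpow_le_rpow_of_exponent_le hC (by linarith)
          _ = C := Real.rpow_one C
  have h2 : R ^ e * R ^ (N * (1 - r)) ≤ 1 := by
    rw [← Real.rpow_add hRp]
    exact Real.rpow_le_one_of_one_le_of_nonpos hR.le he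
  have hYr : 0 ≤ Y ^ r := by positivity
  calc R ^ e * (s * (Y ^ r * V ^ (1 - r)))
      ≤ R ^ e * (s * (Y ^ r * (C * R ^ (N * (1 - r))))) := by gcongr
    _ = (C * (s * Y ^ r)) * (R ^ e * R ^ (N * (1 - r))) := by ring
    _ ≤ (C * (s * Y ^ r)) * 1 := by gcongr
    _ = _ := mul_one _

lemma time_term_le {x t G M C₁ ρ u y : ℝ} {m : ℕ} (hx : 0 ≤ x) (hM : 0 ≤ M)
    (ht : |t| ≤ C₁ * ρ) (hG : |G| ≤ M * u) (hy : x ^ (m + 1) * u ≤ y) :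
    -((m + 2 : ℕ) * x ^ (m + 1) * t * G) ≤ (m + 2) * C₁ * M * ρ * y := by
  have hρ : 0 ≤ C₁ * ρ := (abs_nonneg _).trans ht
  calc _ ≤ |(m + 2 : ℕ) * x ^ (m + 1) * t * G| := neg_le_abs _
    _ = (m + 2) * x ^ (m + 1) * |t| * |G| := by
      rw [abs_mul, abs_mul, abs_of_nonneg (by positivity)]; push_cast; ring
    _ ≤ (m + 2) * x ^ (m + 1) * (C₁ * ρ) * (M * u) := by gcongr
    _ = (m + 2) * M * (C₁ * ρ) * (x ^ (m + 1) * u) := by ring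
    _ ≤ (m + 2) * M * (C₁ * ρ) * y := by gcongr
    _ = _ := by ring

/-- Absorption with `p = -f'` removes `η` and leaves `f² / |f'|` times the cutoff energy. Completing
the square costs two powers of `x`, whence `m` against `m + 2`. -/
lemma gradient_term_le {z : SpaceTime n} (hs : ∀ i j, a z i j = a z j i)
    (hp : ∀ ξ, 0 ≤ form a z ξ ξ) {x f f' M C₂ τ β u y B C₁ ρ : ℝ} {m : ℕ} {ξ η : Fin n → ℝ}
    (hx : 0 ≤ x) (hx1 : x ≤ 1) (hf' : f' < 0) (hf : 0 ≤ f) (hfM : f ≤ M) (hC₂ : 0 ≤ C₂)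
    (hτ : 0 ≤ τ) (hinv : 1 / -f' ≤ C₂ * (τ + τ ^ (-β) * u ^ (1 + β))) (hu : 0 ≤ u)
    (hy : x ^ m * u ^ (1 + β) ≤ y) (hξ : form a z ξ ξ ≤ B * C₁ * ρ) :
    x ^ (m + 2) * form a z η η * f' + form a z (((m + 2 : ℕ) * x ^ (m + 1)) • ξ) η * f
      ≤ M ^ 2 * (m + 2) ^ 2 / 4 * C₂ * B * C₁ * ρ * (τ + τ ^ (-β) * y) := by
  have hab := absorb_gradient hs hp (neg_pos.2 hf') hx (f := f) (m + 2) m ξ η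
  have hsm := form_linear_left (a := a) (z := z) ((m + 2 : ℕ) * x ^ (m + 1)) 0 ξ 0 η
  rw [zero_smul, add_zero, zero_mul, add_zero] at hsm
  rw [hsm]
  have hpow : x ^ m * (τ + τ ^ (-β) * u ^ (1 + β)) ≤ τ + τ ^ (-β) * y := by
    have h1 : x ^ m * τ ≤ τ := mul_le_of_le_one_left hτ (pow_le_one₀ hx hx1)
    have h2 := mul_le_mul_of_nonneg_left hy (Real.rpow_nonneg hτ (-β))
    linarith
  have hpp := hp ξ
  have hB : 0 ≤ B * C₁ * ρ := hpp.trans hξ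
  have hu' : 0 ≤ u ^ (1 + β) := Real.rpow_nonneg hu _
  have hτ' : 0 ≤ τ ^ (-β) := Real.rpow_nonneg hτ _
  have hin : 0 ≤ 1 / -f' := (one_div_pos.2 (neg_pos.2 hf')).le
  calc _ = - -f' * x ^ (m + 2) * form a z η η + f *
        ((m + 2 : ℕ) * x ^ (m + 1) * form a z ξ η) := by ring
    _ ≤ f ^ 2 * (m + 2 : ℕ) ^ 2 / 4 * (1 / -f') * x ^ m * form a z ξ ξ := hab
    _ ≤ M ^ 2 * (m + 2 : ℕ) ^ 2 / 4 * (C₂ * (τ + τ ^ (-β) * u ^ (1 + β))) * x ^ m *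
        (B * C₁ * ρ) := by gcongr
    _ = M ^ 2 * (m + 2) ^ 2 / 4 * C₂ * (B * C₁ * ρ) *
      (x ^ m * (τ + τ ^ (-β) * u ^ (1 + β))) := by push_cast; ring
    _ ≤ M ^ 2 * (m + 2) ^ 2 / 4 * C₂ * (B * C₁ * ρ) * (τ + τ ^ (-β) * y) := by gcongr
    _ = _ := by ring

lemma add_mul_le_mul_add {k₁ k₂ ρ x y : ℝ} (h₁ : 0 ≤ k₁) (h₂ : 0 ≤ k₂) (hρ : 0 ≤ ρ) (hx : 0 ≤ x)
    (hy : 0 ≤ y) : k₁ * ρ * x + k₂ * ρ * y ≤ (k₁ + k₂) * ρ * (x + y) := by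
  have := mul_nonneg (mul_nonneg h₁ hρ) hy
  have := mul_nonneg (mul_nonneg h₂ hρ) hx
  linarith

set_option maxHeartbeats 1000000 in
/-- The weighted energy estimate on parabolic cylinders. -/
lemma exists_weighted_estimate (hn : 1 ≤ n) {α q c β : ℝ} (hq : 1 < q)
    (hqα : q ≤ 1 + α / n) (hβ : β = (q - 1) / 2) (hL : IsAdmissible a A) (hc : 0 < c)
    (hA : ∀ R : ℝ, 1 < R → annulusSup A R ≤ ENNReal.ofReal (c * R ^ (2 - α)))
    {u : SpaceTime n → ℝ} (hu : IsWeakSolution a q u) (hu0 : ∀ᵐ z, 0 ≤ u z) :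
    ∃ C : ℝ, 0 < C ∧ ∀ R : ℝ, 1 < R → ∃ w : SpaceTime n → ℝ, Integrable w ∧
      (∀ z, 0 ≤ w z) ∧ (∀ z, w z ≤ |u z| ^ q) ∧
      (∀ z ∈ cylinder n α R 1, w z = |u z| ^ q) ∧
      ∀ δ : ℝ, 0 < δ → ∫ z, w z ≤ C * ((∫ z in (cylinder n α R 1)ᶜ, w z) ^ (1 / q) + δ
        + δ ^ (-β) * (∫ z in (cylinder n α R 1)ᶜ, w z) ^ ((1 + β) / q)) := by
  obtain ⟨hum, g, V, hW, hweak⟩ := hu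
  have hq0 : 0 < q := by linarith
  have hβ0 : 0 < β := by rw [hβ]; linarith
  have hn0 : (0 : ℝ) < n := by exact_mod_cast hn
  have hnq : n * (q - 1) ≤ α := by
    have : q - 1 ≤ α / n := by linarith
    rw [le_div_iff₀ hn0] at this; linarith
  obtain ⟨M, C₂, hM, hC₂, hprof⟩ := exists_scaled_profile hβ0
  obtain ⟨C₁, hC₁, hcut⟩ := exists_cutoff n α
  obtain ⟨C₃', hC₃', hvol'⟩ := exists_volume_cylinder_le n α
  set C₃ := C₃' + 1 with hC₃def
  have hC₃ : 1 ≤ C₃ := by linarith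
  -- With `1 + β = (q + 1) / 2`, the requirement `(m + 2) (1 + β) ≤ q m` reads `2 (q + 1) ≤ m (q -
  -- 1)`; as `q > 1`, `4 q` is enough.
  obtain ⟨m, hm⟩ := exists_nat_ge (4 * q / (q - 1))
  have hm' : 4 * q ≤ m * (q - 1) := by rwa [div_le_iff₀ (by linarith)] at hm
  set K := (m + 2) * C₁ * M + M ^ 2 * (m + 2) ^ 2 / 4 * C₂ * (c * 2 ^ (2 - α)) * C₁ with hK
  have hK0 : 0 < K := by positivity
  refine ⟨K * C₃, by positivity, fun R hR => ?_⟩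
  have hR0 : 0 < R := by linarith
  obtain ⟨χ, hχs, hχ01, hχ1, hχ0, hχt, hχg, hχd, hχa⟩ := hcut R hR0
  have hχc : HasCompactSupport χ :=
    HasCompactSupport.intro (isCompact_cylinder α R 2) hχ0
  have hψs : ContDiff ℝ ∞ (fun z => χ z ^ (m + 2)) := hχs.pow _
  have hψc : HasCompactSupport (fun z => χ z ^ (m + 2)) :=
    HasCompactSupport.intro (isCompact_cylinder α R 2) fun z hz => by simp [hχ0 z hz]
  have hψ0 : ∀ z, 0 ≤ χ z ^ (m + 2) := fun z => pow_nonneg (hχ01 z).1 _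
  set w : SpaceTime n → ℝ := fun z => |u z| ^ q * χ z ^ (m + 2) with hw
  have hw0 : ∀ z, 0 ≤ w z := fun z => mul_nonneg (by positivity) (hψ0 z)
  have hfder : ∀ z, fderiv ℝ (fun z => χ z ^ (m + 2)) z
      = ((m + 2 : ℕ) * χ z ^ (m + 1)) • fderiv ℝ χ z := fun z =>
    fderiv_pow_succ (hχs.differentiable (by simp) z) (m + 1)
  have htime : ∀ z, timeDeriv (fun z => χ z ^ (m + 2)) z
      = (m + 2 : ℕ) * χ z ^ (m + 1) * timeDeriv χ z := fun z => by
    simp only [timeDeriv, hfder, smul_apply, smul_eq_mul]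
  have hgrad : ∀ z, spaceGrad (fun z => χ z ^ (m + 2)) z
      = ((m + 2 : ℕ) * χ z ^ (m + 1)) • spaceGrad χ z := fun z => by
    ext i; simp only [spaceGrad, hfder, smul_apply, smul_eq_mul, Pi.smul_apply]
  -- Radius `2 R`: the annulus `R < |x| < 2R` carries the spatial gradient of the cutoff.
  have hAR := ae_le_of_annulusSup_le (R := 2 * R) (A := A) (by positivity)
    (hA (2 * R) (by linarith))
  have hQ : ∀ᵐ z, form a z (spaceGrad χ z) (spaceGrad χ z)
      ≤ (c * 2 ^ (2 - α)) * C₁ * R ^ (-α) := by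
    filter_upwards [hAR, hL.form_le] with z h1 h2
    by_cases hz : R < ‖z.2‖ ∧ ‖z.2‖ < 2 * R
    · have h3 : A z ≤ c * (2 * R) ^ (2 - α) := h1 ⟨by linarith [hz.1], hz.2⟩
      calc _ ≤ A z * ∑ i, spaceGrad χ z i ^ 2 := h2 _
        _ ≤ (c * (2 * R) ^ (2 - α)) * (C₁ * R ^ (-2 : ℝ)) :=
          mul_le_mul h3 (hχg z) (Finset.sum_nonneg fun i _ => sq_nonneg _) (by positivity)
        _ = (c * 2 ^ (2 - α)) * C₁ * (R ^ (2 - α) * R ^ (-2 : ℝ)) := by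
          rw [Real.mul_rpow (by norm_num) hR0.le]; ring
        _ = _ := by rw [← Real.rpow_add hR0]; ring_nf
    · rw [hχa z hz]
      simp only [form, Pi.zero_apply, mul_zero, Finset.sum_const_zero]
      positivity
  set Kc : Set (SpaceTime n) := (cylinder n α R 1)ᶜ with hKc
  set D : Set (SpaceTime n) := cylinder n α R 2 ∩ Kc with hD
  have hDm : MeasurableSet D := (isCompact_cylinder α R 2).measurableSet.inter
    (isCompact_cylinder α R 1).measurableSet.compl
  have hDfin : volume D < ⊤ :=
    (measure_mono Set.inter_subset_left).trans_lt (isCompact_cylinder α R 2).measure_lt_top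
  have hDvol : volume.real D ≤ C₃ * R ^ (n + α) := by
    calc volume.real D ≤ volume.real (cylinder n α R 2) :=
          measureReal_mono Set.inter_subset_left (isCompact_cylinder α R 2).measure_lt_top.ne
      _ ≤ C₃' * R ^ (n + α) := hvol' R hR0
      _ ≤ _ := by gcongr; linarith
  have : IsFiniteMeasure (volume.restrict D) :=
    ⟨by rw [Measure.restrict_apply_univ]; exact hDfin⟩
  -- The weight `w` is fixed before `δ`: only the profile depends on `δ`.
  have key : ∀ δ : ℝ, 0 < δ → Integrable w ∧
      ∫ z, w z ≤ K * C₃ * ((∫ z in Kc, w z) ^ (1 / q) + δ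
        + δ ^ (-β) * (∫ z in Kc, w z) ^ ((1 + β) / q)) := by
    intro δ hδ
    -- This scale makes the constant term `R^(-α) τ |D|` comparable to `δ`, as `|D|` is at most of
    -- order `R^(n+α)`.
    set τ := δ * R ^ (-n : ℝ) with hτ
    have hτ0 : 0 < τ := by positivity
    obtain ⟨F, F', hFs, hF'c, hFd, hF1, hF'neg, hF'b, hF'l⟩ := hprof τ hτ0
    have hFabs : ∀ r, |F r| ≤ M := fun r => by
      rw [abs_of_nonneg (zero_le_one.trans (hF1 r).1)]; exact (hF1 r).2
    obtain ⟨G, hGs, hGd, hGl, hGb⟩ := exists_primitive hFs hFabs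
    -- The bound `τ⁻¹` on `F'` only justifies the limits; it does not enter the final constant.
    obtain ⟨j1, j2, j3, j4⟩ := weak_inequality_comp hq hL hum hu0 hW hweak (M := max M τ⁻¹)
      hFs hF'c hFd (fun r => zero_le_one.trans (hF1 r).1)
      (fun r => (hFabs r).trans (le_max_left _ _))
      (fun r => (hF'b r).trans (le_max_right _ _)) hGs hGd
      (fun r s => (hGl r s).trans (by gcongr; exact le_max_left _ _)) hψs hψc hψ0
    refine ⟨j1, ?_⟩
    have hwD : IntegrableOn w D := j1.integrableOn
    have hr1 : 1 / q < 1 := by rw [div_lt_one hq0]; exact hq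
    have hr2 : (1 + β) / q < 1 := by rw [div_lt_one hq0, hβ]; linarith
    have hr1p : 0 < 1 / q := by positivity
    have hr2p : 0 < (1 + β) / q := by positivity
    obtain ⟨k1, k2⟩ := integral_rpow_le hwD hw0 hr1p hr1
    obtain ⟨k3, k4⟩ := integral_rpow_le hwD hw0 hr2p hr2
    rw [measureReal_restrict_apply_univ] at k2 k4
    have k5 : Integrable (fun _ : SpaceTime n => τ) (volume.restrict D) := integrable_const τ
    have hbd : ∀ᵐ z, -(timeDeriv (fun z => χ z ^ (m + 2)) z * G (u z))
        + χ z ^ (m + 2) * form a z (V z) (V z) * F' (u z)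
        + form a z (spaceGrad (fun z => χ z ^ (m + 2)) z) (V z) * F (u z)
        ≤ D.indicator (fun z => K * R ^ (-α) *
          (w z ^ (1 / q) + (τ + τ ^ (-β) * w z ^ ((1 + β) / q)))) z := by
      filter_upwards [hu0, hL.symm, hL.form_nonneg, hQ] with z huz hs hp hQz
      have hx0 := (hχ01 z).1
      have hx1 := (hχ01 z).2
      rw [htime, hgrad]
      by_cases hz : z ∈ D
      · rw [Set.indicator_of_mem hz]
        have hwz : w z = u z ^ q * χ z ^ (m + 2) := by simp only [hw, abs_of_nonneg huz]
        have w1 : χ z ^ (m + 1) * u z ≤ w z ^ (1 / q) := by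
          have := pow_mul_rpow_le (x := u z) (y := χ z) (q := q) (r := 1) (N := m + 2)
            (m := m + 1) huz hx0 hx1 hq0 zero_le_one (by push_cast; nlinarith)
          rwa [Real.rpow_one, ← hwz] at this
        have w2 : χ z ^ m * u z ^ (1 + β) ≤ w z ^ ((1 + β) / q) := by
          have := pow_mul_rpow_le (x := u z) (y := χ z) (q := q) (r := 1 + β) (N := m + 2)
            (m := m) huz hx0 hx1 hq0 (by positivity) (by push_cast; rw [hβ]; nlinarith)
          rwa [← hwz] at this
        have hG := hGb (u z)
        rw [abs_of_nonneg huz] at hG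
        have t1 := time_term_le hx0 hM.le (hχt z) hG w1
        have t2 := gradient_term_le hs hp hx0 hx1 (hF'neg (u z)) (zero_le_one.trans (hF1 _).1)
          (hF1 (u z)).2 hC₂.le hτ0.le (hF'l (u z) huz) huz w2 hQz (η := V z)
        have hτr : 0 ≤ τ + τ ^ (-β) * w z ^ ((1 + β) / q) := by
          have := Real.rpow_nonneg (hw0 z) ((1 + β) / q)
          positivity
        rw [add_assoc]
        refine (add_le_add t1 t2).trans ?_
        exact add_mul_le_mul_add (by positivity) (by positivity) (by positivity)
          (Real.rpow_nonneg (hw0 z) _) hτr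
      -- Off `D` the derivatives of the cutoff vanish, and the remaining term is nonpositive since
      -- `F' < 0`. Hence only the integral outside the inner cylinder appears on the right.
      · rw [Set.indicator_of_notMem hz]
        have hz' : fderiv ℝ χ z = 0 := hχd z (by
          by_contra h
          push Not at h
          exact hz ⟨h.2, h.1⟩)
        have hg0 : spaceGrad χ z = 0 := by ext i; simp [spaceGrad, hz']
        have ht0 : timeDeriv χ z = 0 := by simp [timeDeriv, hz']
        rw [hg0, ht0, smul_zero]
        have : form a z 0 (V z) = 0 := by simp [form]
        rw [this]
        have h1 : χ z ^ (m + 2) * form a z (V z) (V z) * F' (u z) ≤ 0 :=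
          mul_nonpos_of_nonneg_of_nonpos (mul_nonneg (hψ0 z) (hp _)) (hF'neg _).le
        linarith
    simp only [← add_assoc (w _ ^ (1 / q))] at hbd
    have hi : IntegrableOn (fun z => K * R ^ (-α) *
          (w z ^ (1 / q) + τ + τ ^ (-β) * w z ^ ((1 + β) / q))) D :=
      (integrable_add_add k1 k5 (k3.const_mul _)).const_mul _
    have hYmono : ∫ z in D, w z ≤ ∫ z in Kc, w z :=
      setIntegral_mono_set j1.integrableOn (ae_of_all _ hw0) (ae_of_all _ Set.inter_subset_right)
    set Y := ∫ z in Kc, w z with hY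
    have hYD0 : 0 ≤ ∫ z in D, w z := setIntegral_nonneg hDm fun z _ => hw0 z
    have hY0 : 0 ≤ Y := hYD0.trans hYmono
    have b1 : R ^ (-α) * ∫ z in D, w z ^ (1 / q) ≤ C₃ * Y ^ (1 / q) := by
      have h1 := rpow_scaling_bound (e := -α) (s := 1) hC₃ hR hY0 measureReal_nonneg hDvol hr1 hr1p
        zero_le_one (by
          have h2 : -α + (n + α) * (1 - 1 / q) = (n * (q - 1) - α) / q := by
            field_simp; ring
          rw [h2]
          exact div_nonpos_of_nonpos_of_nonneg (by linarith) hq0.le)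
      rw [one_mul, one_mul] at h1
      refine le_trans ?_ h1
      gcongr
      refine k2.trans ?_
      gcongr
    have b2 : R ^ (-α) * ∫ _ in D, τ ≤ C₃ * δ := by
      rw [setIntegral_const, smul_eq_mul, hτ]
      have h1 : R ^ (-α) * R ^ (-n : ℝ) * R ^ (n + α) = 1 := by
        rw [← Real.rpow_add hR0, ← Real.rpow_add hR0]
        convert Real.rpow_zero R using 2
        ring
      calc R ^ (-α) * (volume.real D * (δ * R ^ (-n : ℝ)))
          ≤ R ^ (-α) * ((C₃ * R ^ (n + α)) * (δ * R ^ (-n : ℝ))) := by gcongr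
        _ = C₃ * δ * (R ^ (-α) * R ^ (-n : ℝ) * R ^ (n + α)) := by ring
        _ = _ := by rw [h1, mul_one]
    have b3 : R ^ (-α) * (τ ^ (-β) * ∫ z in D, w z ^ ((1 + β) / q))
        ≤ C₃ * (δ ^ (-β) * Y ^ ((1 + β) / q)) := by
      have h1 := rpow_scaling_bound (e := -α + n * β) (s := δ ^ (-β)) hC₃ hR hY0
        measureReal_nonneg hDvol hr2 hr2p (by positivity) (by
          -- The factor `R^(nβ)` from `τ^(-β)` is exactly balanced at the critical exponent.
          have h2 : -α + n * β + (n + α) * (1 - (1 + β) / q)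
              = (1 + β) * (n * (q - 1) - α) / q := by
            field_simp; ring
          rw [h2]
          exact div_nonpos_of_nonpos_of_nonneg
            (mul_nonpos_of_nonneg_of_nonpos (by linarith) (by linarith)) hq0.le)
      refine le_trans ?_ h1
      have h3 : τ ^ (-β) = δ ^ (-β) * R ^ (n * β) := by
        rw [hτ, Real.mul_rpow hδ.le (by positivity), ← Real.rpow_mul hR0.le]
        ring_nf
      rw [h3, Real.rpow_add hR0]
      have h4 : ∫ z in D, w z ^ ((1 + β) / q)
          ≤ Y ^ ((1 + β) / q) * volume.real D ^ (1 - (1 + β) / q) := by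
        refine k4.trans ?_
        gcongr
      calc _ = R ^ (-α) * R ^ (n * β) * (δ ^ (-β) * ∫ z in D, w z ^ ((1 + β) / q)) := by ring
        _ ≤ _ := by gcongr
    calc ∫ z, w z ≤ ∫ z, |u z| ^ q * χ z ^ (m + 2) * F (u z) :=
          integral_mono j1 j2 fun z => le_mul_of_one_le_right (hw0 z) (hF1 _).1
      _ ≤ _ := j4
      _ ≤ ∫ z, D.indicator (fun z => K * R ^ (-α) *
          (w z ^ (1 / q) + τ + τ ^ (-β) * w z ^ ((1 + β) / q))) z :=
        integral_mono_ae j3 (hi.integrable_indicator hDm) hbd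
      _ = K * (R ^ (-α) * (∫ z in D, w z ^ (1 / q)) + R ^ (-α) * (∫ _ in D, τ)
          + R ^ (-α) * (τ ^ (-β) * ∫ z in D, w z ^ ((1 + β) / q))) := by
        rw [integral_indicator hDm, integral_const_mul,
          integral_add_add k1 k5 (k3.const_mul _), integral_const_mul (τ ^ (-β))]
        ring
      _ ≤ K * (C₃ * Y ^ (1 / q) + C₃ * δ + C₃ * (δ ^ (-β) * Y ^ ((1 + β) / q))) := by gcongr
      _ = _ := by ring
  refine ⟨w, (key 1 one_pos).1, hw0, fun z => ?_, fun z hz => ?_, fun δ hδ => (key δ hδ).2⟩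
  · exact mul_le_of_le_one_right (by positivity) (pow_le_one₀ (hχ01 z).1 (hχ01 z).2)
  · simp [hw, hχ1 z hz]

/-! ### From the estimate to the vanishing of the solution. -/

/-- For `X > 1` the power `X ^ p` dominates the other two terms, so `X ^ (1 - p) ≤ 3 C`, and `p < 1`
allows solving for `X`. -/
lemma le_of_le_rpow_sum {C X p r : ℝ} (hC : 0 < C) (hp1 : p < 1)
    (hrp : r ≤ p) (hp0 : 0 ≤ p) (h : X ≤ C * (X ^ r + 1 + X ^ p)) :
    X ≤ max 1 ((3 * C) ^ (1 / (1 - p))) := by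
  rcases le_or_gt X 1 with h1 | h1
  · exact h1.trans (le_max_left _ _)
  · refine le_max_of_le_right ?_
    have hX : 0 < X := by linarith
    have e1 : X ^ r ≤ X ^ p := Real.rpow_le_rpow_of_exponent_le h1.le hrp
    have e2 : 1 ≤ X ^ p := Real.one_le_rpow h1.le hp0
    have e3 : X ≤ 3 * C * X ^ p := by nlinarith
    have e4 : X ^ (1 - p) ≤ 3 * C := by
      rw [Real.rpow_sub hX, Real.rpow_one, div_le_iff₀ (by positivity)]
      exact e3
    calc X = (X ^ (1 - p)) ^ (1 / (1 - p)) := by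
          rw [← Real.rpow_mul hX.le, mul_one_div_cancel (by linarith), Real.rpow_one]
      _ ≤ _ := Real.rpow_le_rpow (by positivity) e4 (by
          apply div_nonneg zero_le_one; linarith)

lemma aecover_cylinder {α : ℝ} (hα : 0 < α) :
    AECover (volume : Measure (SpaceTime n)) atTop
      (fun k : ℕ => cylinder n α ((k : ℝ) + 2) 1) where
  ae_eventually_mem := ae_of_all _ fun z => by
    have h1 : Tendsto (fun k : ℕ => (k : ℝ) + 2) atTop atTop :=
      tendsto_atTop_add_const_right _ _ tendsto_natCast_atTop_atTop
    have h2 := (tendsto_rpow_atTop hα).comp h1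
    filter_upwards [h1.eventually_ge_atTop ‖z.2‖, h2.eventually_ge_atTop |z.1|] with k h3 h4
    exact ⟨by simpa using h4, by simpa using h3⟩
  measurableSet k := (isCompact_cylinder α _ 1).measurableSet

end ParabolicLiouville

end

open ParabolicLiouville in
theorem theorem3 (n : ℕ) (hn : 1 ≤ n) (α q : ℝ) (hα : 0 < α) (hq : 1 < q)
    (hqα : q ≤ 1 + α / n)
    (a : ParabolicLiouville.SpaceTime n → Matrix (Fin n) (Fin n) ℝ)
    (A : ParabolicLiouville.SpaceTime n → ℝ)
    (hL : ParabolicLiouville.IsAdmissible a A)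
    (c : ℝ) (hc : 0 < c)
    (hA : ∀ R : ℝ, 1 < R →
      ParabolicLiouville.annulusSup A R ≤ ENNReal.ofReal (c * R ^ (2 - α)))
    (u : ParabolicLiouville.SpaceTime n → ℝ)
    (hu : ParabolicLiouville.IsWeakSolution a q u)
    (hu0 : ∀ᵐ z, 0 ≤ u z) :
    ∀ᵐ z, u z = 0 := by
  obtain ⟨C, hC, hest⟩ := exists_weighted_estimate hn hq hqα rfl hL hc hA hu hu0
  set β := (q - 1) / 2 with hβ
  have hq0 : 0 < q := by linarith
  have hβ0 : 0 < β := by rw [hβ]; linarith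
  have hr1 : 0 < 1 / q := by positivity
  have hr2 : 0 < (1 + β) / q := by positivity
  set R : ℕ → ℝ := fun k => (k : ℝ) + 2 with hR
  have hR1 : ∀ k, 1 < R k := fun k => by
    have : (0 : ℝ) ≤ k := Nat.cast_nonneg k
    simp only [hR]; linarith
  choose w hwi hw0 hwle hweq hw using fun k => hest (R k) (hR1 k)
  have hcov := aecover_cylinder (n := n) hα
  have hKm : ∀ k, MeasurableSet (cylinder n α (R k) 1) := fun k => hcov.measurableSet k
  have hf0 : ∀ z, 0 ≤ |u z| ^ q := fun z => by positivity
  have hfK : ∀ k, IntegrableOn (fun z => |u z| ^ q) (cylinder n α (R k) 1) := fun k =>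
    (hwi k).integrableOn.congr_fun (hweq k) (hKm k)
  have hfw : ∀ k, ∫ z in cylinder n α (R k) 1, |u z| ^ q ≤ ∫ z, w k z := fun k => by
    rw [← setIntegral_congr_fun (hKm k) (hweq k)]
    exact setIntegral_le_integral (hwi k) (ae_of_all _ (hw0 k))
  have hYX : ∀ k, ∫ z in (cylinder n α (R k) 1)ᶜ, w k z ≤ ∫ z, w k z := fun k =>
    setIntegral_le_integral (hwi k) (ae_of_all _ (hw0 k))
  have hY0 : ∀ k, 0 ≤ ∫ z in (cylinder n α (R k) 1)ᶜ, w k z := fun k =>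
    setIntegral_nonneg (hKm k).compl fun z _ => hw0 k z
  -- Here `δ = 1`, and the outer integral is bounded by the whole one.
  have hbound : ∀ k, ∫ z, w k z ≤ max 1 ((3 * C) ^ (1 / (1 - (1 + β) / q))) := fun k => by
    refine le_of_le_rpow_sum (r := 1 / q) hC ?_ ?_ hr2.le ?_
    · rw [div_lt_one hq0, hβ]; linarith
    · gcongr; linarith
    · have h1 := hw k 1 one_pos
      rw [Real.one_rpow, one_mul] at h1
      refine h1.trans ?_
      have h2 := hYX k
      have h3 := hY0 k
      gcongr
  have hfi : Integrable (fun z => |u z| ^ q) :=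
    hcov.integrable_of_integral_bounded_of_nonneg_ae _ hfK (ae_of_all _ hf0)
      (Eventually.of_forall fun k => (hfw k).trans (hbound k))
  have hlim := hcov.integral_tendsto_of_countably_generated hfi
  -- The weights change with `k`, but all lie below the integrable `|u|^q`, whose tail tends to
  -- zero.
  have hYlim : Tendsto (fun k => ∫ z in (cylinder n α (R k) 1)ᶜ, w k z) atTop (𝓝 0) := by
    have h1 : Tendsto (fun k => (∫ z, |u z| ^ q) - ∫ z in cylinder n α (R k) 1, |u z| ^ q) atTop
        (𝓝 0) := by
      simpa using hlim.const_sub (∫ z, |u z| ^ q)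
    refine squeeze_zero hY0 (fun k => ?_) h1
    rw [← integral_add_compl (hKm k) hfi, add_sub_cancel_left]
    exact setIntegral_mono (hwi k).integrableOn hfi.integrableOn (hwle k)
  -- The limit `k → ∞` is taken with `δ` fixed, so the factor `δ^(-β)` does no harm.
  have hle : ∀ δ : ℝ, 0 < δ → ∫ z, |u z| ^ q ≤ C * δ := fun δ hδ => by
    have h1 := (hYlim.rpow_const (Or.inr hr1.le)).add_const δ
    have h2 := (hYlim.rpow_const (Or.inr hr2.le)).const_mul (δ ^ (-β))
    have h3 := (h1.add h2).const_mul C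
    rw [Real.zero_rpow hr1.ne', Real.zero_rpow hr2.ne', zero_add, mul_zero, add_zero] at h3
    exact le_of_tendsto_of_tendsto' hlim h3 fun k => (hfw k).trans (hw k δ hδ)
  have hzero : ∫ z, |u z| ^ q = 0 := by
    refine le_antisymm (le_of_forall_pos_le_add fun ε hε => ?_) (integral_nonneg hf0)
    have := hle (ε / C) (by positivity)
    rwa [mul_div_cancel₀ _ hC.ne', ← zero_add ε] at this
  rw [integral_eq_zero_iff_of_nonneg hf0 hfi] at hzero
  filter_upwards [hzero] with z hz
  exact abs_eq_zero.1 ((Real.rpow_eq_zero (abs_nonneg _) hq0.ne').1 hz)
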